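/- Let $\Gamma$ be a discrete group that is not $C^*$-simple, i.e. the reduced group $C^*$-algebra $C^*_r(\Gamma)$ has a closed two-sided ideal other than $0$ and $C^*_r(\Gamma)$. Let $\Gamma_f=\{h\in\Gamma : h \text{ has a finite conjugacy class}\}$ denote the FC-center of $\Gamma$. For a unital $C^*$-algebra $\mathcal A$ with an action of $\Gamma$ by $*$-automorphisms (a $\Gamma$-$C^*$-algebra) and a faithful representation $\pi:\mathcal A\to\mathbb B(\mathcal H)$, the reduced crossed product $\mathcal A\rtimes_r\Gamma$ is the $C^*$-algebra of operators on $\ell^2(\Gamma,\mathcal H)$ generated by $\sigma(a)$, $a\in\mathcal A$, and $\lambda_s$, $s\in\Gamma$, where $(\sigma(a)\xi)(t)=\pi(t^{-1}a)\xi(t)$ and $(\lambda_s\xi)(t)=\xi(s^{-1}t)$. The $\lambda_s$ generate the copy of $C^*_r(\Gamma)$ in it, $\mathcal A$ is identified with $\sigma(\mathcal A)$, and for a $\Gamma$-invariant unital $C^*$-subalgebra $\mathcal B\subset\mathcal A$, $\mathcal B\rtimes_r\Gamma\subset\mathcal A\rtimes_r\Gamma$ is the $C^*$-subalgebra generated by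 $\sigma(\mathcal B)$ and the $\lambda_s$. (a) Let $\mathcal A\neq\mathbb C$ be a unital $\Gamma$-$C^*$-algebra admitting a faithful $\Gamma$-invariant state. Assume that at least one of the following holds: - $\mathcal A\cong C(X)$ for a compact Hausdorff space $X$ with $|X|\ge 3$; - $\Gamma_f\not\cong\mathbb Z/2\mathbb Z$. Then there is an intermediate $C^*$-algebra $C^*_r(\Gamma)\subset\mathcal D\subset\mathcal A\rtimes_r\Gamma$ which is not equal to $\mathcal B\rtimes_r\Gamma$ for any $\Gamma$-invariant unital $C^*$-subalgebra $\mathcal B\subset\mathcal A$. If $\mathcal A$ is commutative, then $\mathcal D$ can moreover be chosen with $\mathcal D\cap\mathcal A=\mathbb C$. (b) Let $X$ be a compact Hausdorff space with at least three points on which $\Gamma$ acts by homeomorphisms, and assume that there is a $\Gamma$-invariant Borel probability measure on $X$ of full support. Let $\Gamma$ act on $C(X)$ by $(sf)(x)=f(s^{-1}x)$. Then there is an intermediate $C^*$-algebra $C^*_r(\Gamma)\subsetneq\mathcal D\subsetneq C(X)\rtimes_r\Gamma$ which is not equal to $\mathcal B\rtimes_r\Gamma$ for any $\Gamma$-invariant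 unital $C^*$-subalgebra $\mathcal B\subset C(X)$, and which satisfies $\mathcal D\cap C(X)=\mathbb C$. -/

import Mathlib

open scoped ComplexOrder

noncomputable section

/-- The Hilbert space `ℓ²(Γ, H)` of square summable `H`-valued functions on `Γ`. -/
abbrev L2 (Γ : Type*) (H : Type*) [NormedAddCommGroup H] [InnerProductSpace ℂ H] : Type _ :=
  lp (fun _ : Γ => H) 2

namespace L2

theorem norm_sq_eq {Γ H : Type*} [NormedAddCommGroup H] [InnerProductSpace ℂ H] (ξ : L2 Γ H) :
    ‖ξ‖ ^ 2 = ∑' t, ‖ξ t‖ ^ 2 := by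
  have h := lp.norm_rpow_eq_tsum (p := 2) (by norm_num) ξ
  simpa using h

theorem summable_norm_sq {Γ H : Type*} [NormedAddCommGroup H] [InnerProductSpace ℂ H]
    (ξ : L2 Γ H) : Summable fun t => ‖ξ t‖ ^ 2 := by
  have h := (lp.memℓp ξ).summable (by norm_num)
  simpa using h

theorem memlp_two {Γ H : Type*} [NormedAddCommGroup H] [InnerProductSpace ℂ H] {f : Γ → H}
    (hf : Summable fun t => ‖f t‖ ^ 2) : Memℓp f 2 :=
  memℓp_gen (by simpa using hf)

/-- The left translation operator `(λ_s ξ)(t) = ξ(s⁻¹ t)` on `ℓ²(Γ, H)`. -/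
def translate {Γ : Type*} [Group Γ] (H : Type*) [NormedAddCommGroup H] [InnerProductSpace ℂ H]
    (s : Γ) : L2 Γ H →L[ℂ] L2 Γ H :=
  LinearMap.mkContinuous
    { toFun := fun ξ => ⟨fun t => ξ (s⁻¹ * t), memlp_two
        ((Equiv.mulLeft s⁻¹).summable_iff.mpr (summable_norm_sq ξ))⟩
      map_add' := fun _ _ => rfl
      map_smul' := fun _ _ => rfl } 1
    (fun ξ => by
      rw [one_mul]
      refine (sq_le_sq₀ (norm_nonneg _) (norm_nonneg _)).mp (le_of_eq ?_)
      rw [norm_sq_eq, norm_sq_eq]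
      exact (Equiv.mulLeft s⁻¹).tsum_eq fun t => ‖ξ t‖ ^ 2)

@[simp] theorem translate_apply {Γ : Type*} [Group Γ] {H : Type*} [NormedAddCommGroup H]
    [InnerProductSpace ℂ H] (s : Γ) (ξ : L2 Γ H) (t : Γ) :
    translate H s ξ t = ξ (s⁻¹ * t) := rfl

/-- The left translation representation `s ↦ λ_s` of `Γ` on `ℓ²(Γ, H)`. -/
def leftTranslation (Γ : Type*) [Group Γ] (H : Type*) [NormedAddCommGroup H]
    [InnerProductSpace ℂ H] : Γ →* (L2 Γ H →L[ℂ] L2 Γ H) where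
  toFun := translate H
  map_one' := by ext ξ t; simp
  map_mul' r s := by ext ξ t; simp [mul_assoc]

@[simp] theorem leftTranslation_apply {Γ : Type*} [Group Γ] {H : Type*} [NormedAddCommGroup H]
    [InnerProductSpace ℂ H] (s : Γ) (ξ : L2 Γ H) (t : Γ) :
    leftTranslation Γ H s ξ t = ξ (s⁻¹ * t) := rfl

/-- The diagonal operator `(ξ(t))_t ↦ (T t (ξ(t)))_t` on `ℓ²(Γ, H)` attached to a uniformly bounded
family of operators `T t` on `H`. -/
def diagonal {Γ H : Type*} [NormedAddCommGroup H] [InnerProductSpace ℂ H]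
    (T : Γ → H →L[ℂ] H) (C : ℝ) (hT : ∀ t, ‖T t‖ ≤ C) : L2 Γ H →L[ℂ] L2 Γ H :=
  have key : ∀ (ξ : L2 Γ H) (t : Γ), ‖T t (ξ t)‖ ^ 2 ≤ C ^ 2 * ‖ξ t‖ ^ 2 := fun ξ t => by
    rw [← mul_pow]
    exact pow_le_pow_left₀ (norm_nonneg _) ((T t).le_of_opNorm_le (hT t) _) 2
  have hsum : ∀ ξ : L2 Γ H, Summable fun t => ‖T t (ξ t)‖ ^ 2 := fun ξ =>
    Summable.of_nonneg_of_le (fun _ => sq_nonneg _) (key ξ) ((summable_norm_sq ξ).mul_left _)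
  LinearMap.mkContinuous
    { toFun := fun ξ => ⟨fun t => T t (ξ t), memlp_two (hsum ξ)⟩
      map_add' := fun ξ η => lp.ext (funext fun t => (T t).map_add (ξ t) (η t))
      map_smul' := fun c ξ => lp.ext (funext fun t => (T t).map_smul c (ξ t)) } |C|
    (fun ξ => by
      refine (sq_le_sq₀ (norm_nonneg _) (by positivity)).mp ?_
      rw [mul_pow, sq_abs, norm_sq_eq, norm_sq_eq, ← tsum_mul_left]
      exact (hsum ξ).tsum_le_tsum (key ξ) ((summable_norm_sq ξ).mul_left _))

@[simp] theorem diagonal_apply {Γ H : Type*} [NormedAddCommGroup H] [InnerProductSpace ℂ H]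
    (T : Γ → H →L[ℂ] H) (C : ℝ) (hT : ∀ t, ‖T t‖ ≤ C) (ξ : L2 Γ H) (t : Γ) :
    diagonal T C hT ξ t = T t (ξ t) := rfl

end L2

/-- The C⋆-algebra of operators on `ℓ²(Γ, H)` generated by the left translations `λ_s`, `s ∈ Γ`.
For `H = ℂ` this is the reduced group C⋆-algebra acting on `ℓ²(Γ)`; for `H ≠ 0` it is the copy of
`C⋆_r(Γ)` inside a reduced crossed product acting on `ℓ²(Γ, H)`. -/
def reducedGroupCStar (Γ : Type*) [Group Γ] (H : Type*) [NormedAddCommGroup H]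
    [InnerProductSpace ℂ H] [CompleteSpace H] : StarSubalgebra ℂ (L2 Γ H →L[ℂ] L2 Γ H) :=
  (StarAlgebra.adjoin ℂ (Set.range (L2.leftTranslation Γ H))).topologicalClosure

/-- `Γ` is C⋆-simple: the only closed two-sided ideals of `C⋆_r(Γ)` are `0` and `C⋆_r(Γ)`. -/
def IsCStarSimple (Γ : Type*) [Group Γ] : Prop :=
  ∀ I : TwoSidedIdeal (reducedGroupCStar Γ ℂ),
    IsClosed (I : Set (reducedGroupCStar Γ ℂ)) → I = ⊥ ∨ I = ⊤

/-- The FC-center of `Γ`: the subgroup of the elements with a finite conjugacy class. -/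
def fcCenter (Γ : Type*) [Group Γ] : Subgroup Γ where
  carrier := {h | (conjugatesOf h).Finite}
  one_mem' := by simp [conjugatesOf]
  mul_mem' := by
    intro a b ha hb
    refine (ha.mul hb).subset ?_
    intro x hx
    obtain ⟨c, rfl⟩ := isConj_iff.mp hx
    exact ⟨c * a * c⁻¹, isConj_iff.mpr ⟨c, rfl⟩,
      c * b * c⁻¹, isConj_iff.mpr ⟨c, rfl⟩, by group⟩
  inv_mem' := by
    intro a ha
    refine ha.inv.subset ?_
    intro x hx
    obtain ⟨c, rfl⟩ := isConj_iff.mp hx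
    exact isConj_iff.mpr ⟨c, by group⟩

/-- The representation `σ` of the `Γ`-C⋆-algebra `A` on `ℓ²(Γ, H)` attached to a representation `π`
of `A` on `H`: `(σ(a)ξ)(t) = π(t⁻¹ a) ξ(t)`. -/
def regularRep {Γ : Type*} [Group Γ] {A : Type*} [CStarAlgebra A] (α : Γ →* (A ≃⋆ₐ[ℂ] A))
    {H : Type*} [NormedAddCommGroup H] [InnerProductSpace ℂ H] [CompleteSpace H]
    (π : A →⋆ₐ[ℂ] (H →L[ℂ] H)) : A →⋆ₐ[ℂ] (L2 Γ H →L[ℂ] L2 Γ H) where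
  toFun a := L2.diagonal (fun t => π (α t⁻¹ a)) ‖a‖ (fun t =>
    (NonUnitalStarAlgHom.norm_apply_le π _).trans (NonUnitalStarAlgHom.norm_apply_le (α t⁻¹) _))
  map_one' := by ext ξ t; simp
  map_mul' a b := by ext ξ t; simp
  map_zero' := by ext ξ t; simp
  map_add' a b := by ext ξ t; simp
  commutes' c := by
    ext ξ t
    simp [Algebra.algebraMap_eq_smul_one]
  map_star' a := by
    rw [ContinuousLinearMap.star_eq_adjoint, ContinuousLinearMap.eq_adjoint_iff]
    intro ξ η
    rw [lp.inner_eq_tsum, lp.inner_eq_tsum]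
    refine tsum_congr fun t => ?_
    rw [L2.diagonal_apply, L2.diagonal_apply, map_star, map_star,
      ContinuousLinearMap.star_eq_adjoint, ContinuousLinearMap.adjoint_inner_left]

@[simp] theorem regularRep_apply {Γ : Type*} [Group Γ] {A : Type*} [CStarAlgebra A]
    (α : Γ →* (A ≃⋆ₐ[ℂ] A)) {H : Type*} [NormedAddCommGroup H] [InnerProductSpace ℂ H]
    [CompleteSpace H] (π : A →⋆ₐ[ℂ] (H →L[ℂ] H)) (a : A) (ξ : L2 Γ H) (t : Γ) :
    regularRep α π a ξ t = π (α t⁻¹ a) (ξ t) := rfl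

/-- The reduced crossed product `B ⋊_r Γ` of a `Γ`-invariant C⋆-subalgebra `B ∋ 1` of `A`, realized
on `ℓ²(Γ, H)` through a faithful representation `π` of `A` on `H`: the C⋆-algebra generated by
`σ(B)` and the left translations. -/
def reducedCrossedProduct {Γ : Type*} [Group Γ] {A : Type*} [CStarAlgebra A]
    (α : Γ →* (A ≃⋆ₐ[ℂ] A)) {H : Type*} [NormedAddCommGroup H] [InnerProductSpace ℂ H]
    [CompleteSpace H] (π : A →⋆ₐ[ℂ] (H →L[ℂ] H)) (B : StarSubalgebra ℂ A) :
    StarSubalgebra ℂ (L2 Γ H →L[ℂ] L2 Γ H) :=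
  (StarAlgebra.adjoin ℂ
    (regularRep α π '' (B : Set A) ∪ Set.range (L2.leftTranslation Γ H))).topologicalClosure

/-- `D` is of the form `B ⋊_r Γ` for some `Γ`-invariant C⋆-subalgebra `B` of `A`. -/
def IsSubCrossedProduct {Γ : Type*} [Group Γ] {A : Type*} [CStarAlgebra A]
    (α : Γ →* (A ≃⋆ₐ[ℂ] A)) {H : Type*} [NormedAddCommGroup H] [InnerProductSpace ℂ H]
    [CompleteSpace H] (π : A →⋆ₐ[ℂ] (H →L[ℂ] H))
    (D : StarSubalgebra ℂ (L2 Γ H →L[ℂ] L2 Γ H)) : Prop :=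
  ∃ B : StarSubalgebra ℂ A, IsClosed (B : Set A) ∧ (∀ (s : Γ), ∀ b ∈ B, α s b ∈ B) ∧
    D = reducedCrossedProduct α π B

/-- `φ` is a faithful `Γ`-invariant state on `A`. Positive functionals are automatically bounded. -/
structure IsFaithfulInvariantState {Γ : Type*} [Group Γ] {A : Type*} [CStarAlgebra A]
    (α : Γ →* (A ≃⋆ₐ[ℂ] A)) (φ : A →ₗ[ℂ] ℂ) : Prop where
  nonneg : ∀ a, 0 ≤ φ (star a * a)
  map_one : φ 1 = 1
  faithful : ∀ a, φ (star a * a) = 0 → a = 0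
  invariant : ∀ (s : Γ) (a : A), φ (α s a) = φ a

/-- The action of `Γ` on `C(X)` induced by an action of `Γ` on `X` by homeomorphisms:
`(s f)(x) = f(s⁻¹ x)`. -/
def functionAction (Γ : Type*) [Group Γ] (X : Type*) [TopologicalSpace X] [CompactSpace X]
    [MulAction Γ X] [ContinuousConstSMul Γ X] : Γ →* (C(X, ℂ) ≃⋆ₐ[ℂ] C(X, ℂ)) where
  toFun s := (Homeomorph.smul s⁻¹).compStarAlgEquiv' ℂ ℂ
  map_one' := by ext f x; simp
  map_mul' r s := by ext f x; simp [mul_smul]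

@[simp] theorem functionAction_apply {Γ : Type*} [Group Γ] {X : Type*} [TopologicalSpace X]
    [CompactSpace X] [MulAction Γ X] [ContinuousConstSMul Γ X] (s : Γ) (f : C(X, ℂ)) (x : X) :
    functionAction Γ X s f x = f (s⁻¹ • x) := rfl

end

/-! A faithful invariant state `φ` induces a faithful conditional expectation `E` from the crossed
product onto `C⋆_r(Γ)`, determined by `E(σ(a) λ_s) = φ(a) λ_s`. For a proper closed ideal `J` of
`C⋆_r(Γ)`, let `D` be the multiplicative domain of `E` followed by the quotient map modulo `J`. It
contains `C⋆_r(Γ)`, on which `E` is already multiplicative, and every product `x z y` with `x, y` in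
`J` and `z` arbitrary. It meets `A` only in the scalars: if `σ(b)` is in `D`, the scalar `φ(b⋆b) -
φ(b⋆)φ(b)` lies in `J`, hence vanishes, and faithfulness of `φ` gives `b = φ(b)1`.

If `D` were `B ⋊_r Γ`, then `B` would be `ℂ`, so `D = C⋆_r(Γ)` and `J σ(A) J ⊆ C⋆_r(Γ)`. It remains
to choose `J` violating this inclusion (`exists_intermediate_of_ideal`). The test is that
compressing an element of `C⋆_r(Γ)` to the copy of `H` at the identity gives a scalar.

If the FC-center is trivial, any nontrivial `J` works (`exists_intermediate_of_icc`). By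
`delta_one_mem_closure` there are `y_n` in `J` with `y_n δ_1 → δ_1`; compressing `y_n⋆ σ(a) y_n` and
passing to the limit would make every `a` scalar.

If the FC-center is nontrivial, it yields a finite or abelian normal subgroup `N` such that the
indicator of `N` extends to a bounded functional of `λ_s`. The ideal `J` of that functional contains
all `1 - λ_n`, `n ∈ N` (`exists_intermediate_of_normal`). The compression of `(1 - λ_s) σ(a) (1 -
λ_t)` is `a` when `s, t, st ≠ 1`, which again would force `A = ℂ`. Such `s, t` exist unless the
FC-center has order two; then `s = t` and the compression is `a + s a`, which cannot be scalar for
every `a` in `C(X)` when `X` has three points. -/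

noncomputable section

/-! ### Elementary vectors and operators on `ℓ²(Γ, H)`. -/

namespace L2

variable {Γ : Type*} {H : Type*} [NormedAddCommGroup H] [InnerProductSpace ℂ H]

open scoped Classical in
/-- The embedding `h ↦ δ_t ⊗ h` of `H` into `ℓ²(Γ, H)`. -/
def delta (t : Γ) : H →L[ℂ] L2 Γ H :=
  lp.singleContinuousLinearMap ℂ (fun _ : Γ => H) 2 t

open scoped Classical in
theorem delta_apply (t : Γ) (h : H) (s : Γ) : delta t h s = if s = t then h else 0 := by
  simp [delta, lp.single_apply, Pi.single_apply]

@[simp] theorem delta_apply_self (t : Γ) (h : H) : delta t h t = h := by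
  simp [delta_apply]

theorem delta_apply_ne {s t : Γ} (hst : s ≠ t) (h : H) : delta t h s = 0 := by
  simp [delta_apply, hst]

@[simp] theorem norm_delta (t : Γ) (h : H) : ‖delta t h‖ = ‖h‖ := by
  simp [delta, lp.norm_single]

@[simp] theorem inner_delta_left (t : Γ) (h : H) (ξ : L2 Γ H) :
    inner ℂ (delta t h) ξ = inner ℂ h (ξ t) := by
  classical
  have hd : delta t h = lp.single (E := fun _ : Γ => H) 2 t h := by
    ext s
    simp [delta_apply, lp.single_apply, Pi.single_apply]
  rw [hd]
  exact lp.inner_single_left (𝕜 := ℂ) t h ξ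

@[simp] theorem inner_delta_right (t : Γ) (h : H) (ξ : L2 Γ H) :
    inner ℂ ξ (delta t h) = inner ℂ (ξ t) h := by
  rw [← inner_conj_symm, inner_delta_left, inner_conj_symm]

theorem hasSum_delta (ξ : L2 Γ H) : HasSum (fun t => delta t (ξ t)) ξ := by
  classical
  have := lp.hasSum_single (p := 2) (by simp) ξ
  convert this using 2 with t
  ext s
  simp [delta_apply, lp.single_apply, Pi.single_apply]

/-- Operators agreeing on all `δ_t ⊗ h` agree. -/
theorem clm_ext {F : Type*} [NormedAddCommGroup F] [NormedSpace ℂ F] {x y : L2 Γ H →L[ℂ] F}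
    (h : ∀ t v, x (delta t v) = y (delta t v)) : x = y := by
  ext ξ
  have h1 := (hasSum_delta ξ).mapL x
  have h2 := (hasSum_delta ξ).mapL y
  simp only [h] at h1
  exact h1.unique h2

/-- The coordinate map `ξ ↦ ξ(t)`. -/
def coord (t : Γ) : L2 Γ H →L[ℂ] H := lp.evalCLM ℂ (fun _ : Γ => H) 2 t

@[simp] theorem coord_apply (t : Γ) (ξ : L2 Γ H) : coord t ξ = ξ t := rfl

theorem adjoint_delta [CompleteSpace H] (t : Γ) :
    ContinuousLinearMap.adjoint (delta t : H →L[ℂ] L2 Γ H) = coord t := by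
  symm
  rw [ContinuousLinearMap.eq_adjoint_iff]
  intro x y
  simp

variable [Group Γ]

@[simp] theorem leftTranslation_delta (s t : Γ) (h : H) :
    leftTranslation Γ H s (delta t h) = delta (s * t) h := by
  classical
  ext r
  simp [delta_apply, inv_mul_eq_iff_eq_mul]

theorem star_leftTranslation [CompleteSpace H] (s : Γ) :
    star (leftTranslation Γ H s) = leftTranslation Γ H s⁻¹ := by
  symm
  rw [ContinuousLinearMap.star_eq_adjoint, ContinuousLinearMap.eq_adjoint_iff]
  intro ξ η
  rw [lp.inner_eq_tsum, lp.inner_eq_tsum, ← (Equiv.mulLeft s⁻¹).tsum_eq]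
  simp

end L2

/-! ### Density and induction principles for `C⋆_r(Γ)` and `A ⋊_r Γ`. -/

open L2

theorem StarAlgebra.adjoin_toSubmodule_eq_span {R : Type*} [Ring R] [StarRing R] [Algebra ℂ R]
    [StarModule ℂ R] (S : Submonoid R) (hS : ∀ x ∈ S, star x ∈ S) :
    Subalgebra.toSubmodule (StarAlgebra.adjoin ℂ (S : Set R)).toSubalgebra
      = Submodule.span ℂ (S : Set R) := by
  have : (S : Set R) ∪ star (S : Set R) = S := by
    refine Set.union_eq_left.mpr fun x hx => ?_
    simpa using hS _ (Set.mem_star.mp hx)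
  rw [StarAlgebra.adjoin_toSubalgebra, this, Algebra.adjoin_eq_span, Submonoid.closure_eq]

section

variable {Γ : Type*} [Group Γ] {H : Type*} [NormedAddCommGroup H] [InnerProductSpace ℂ H]
  [CompleteSpace H]

theorem leftTranslation_mem_reducedGroupCStar (s : Γ) :
    leftTranslation Γ H s ∈ reducedGroupCStar Γ H :=
  StarSubalgebra.le_topologicalClosure _ (StarAlgebra.subset_adjoin ℂ _ ⟨s, rfl⟩)

theorem isClosed_reducedGroupCStar :
    IsClosed (reducedGroupCStar Γ H : Set (L2 Γ H →L[ℂ] L2 Γ H)) :=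
  StarSubalgebra.isClosed_topologicalClosure _

/-- Since `S` is closed under products and adjoints, its linear span is already the generated
⋆-algebra, so a closed linear condition need only be checked on `S`. -/
theorem topologicalClosure_adjoin_induction {R : Type*} [CStarAlgebra R] (S : Submonoid R)
    (hS : ∀ x ∈ S, star x ∈ S) (V : Submodule ℂ R) (hV : IsClosed (V : Set R))
    (h : ∀ x ∈ S, x ∈ V) {x : R}
    (hx : x ∈ (StarAlgebra.adjoin ℂ (S : Set R)).topologicalClosure) : x ∈ V := by
  have h1 : ((StarAlgebra.adjoin ℂ (S : Set R)) : Set R) ⊆ V := by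
    intro y hy
    have : y ∈ Submodule.span ℂ (S : Set R) := by
      rw [← StarAlgebra.adjoin_toSubmodule_eq_span S hS]; exact hy
    exact Submodule.span_le.mpr h this
  have hx' : x ∈ closure ((StarAlgebra.adjoin ℂ (S : Set R)) : Set R) := by
    rw [← StarSubalgebra.topologicalClosure_coe]; exact hx
  exact closure_minimal h1 hV hx'

/-- The elements of `C⋆_r(Γ)` lie in every closed subspace containing the translations. -/
theorem reducedGroupCStar_induction (V : Submodule ℂ (L2 Γ H →L[ℂ] L2 Γ H))
    (hV : IsClosed (V : Set (L2 Γ H →L[ℂ] L2 Γ H))) (h : ∀ s, leftTranslation Γ H s ∈ V)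
    {x : L2 Γ H →L[ℂ] L2 Γ H} (hx : x ∈ reducedGroupCStar Γ H) : x ∈ V := by
  refine topologicalClosure_adjoin_induction (MonoidHom.mrange (leftTranslation Γ H)) ?_ V hV ?_ hx
  · rintro _ ⟨s, rfl⟩
    exact ⟨s⁻¹, (star_leftTranslation s).symm⟩
  · rintro _ ⟨s, rfl⟩
    exact h s

theorem reducedGroupCStar_le {S : StarSubalgebra ℂ (L2 Γ H →L[ℂ] L2 Γ H)}
    (hS : IsClosed (S : Set (L2 Γ H →L[ℂ] L2 Γ H))) (h : ∀ s, leftTranslation Γ H s ∈ S) :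
    reducedGroupCStar Γ H ≤ S := by
  refine StarSubalgebra.topologicalClosure_minimal (StarAlgebra.adjoin_le ?_) hS
  rintro _ ⟨s, rfl⟩
  exact h s

variable {A : Type*} [CStarAlgebra A] (α : Γ →* (A ≃⋆ₐ[ℂ] A)) (π : A →⋆ₐ[ℂ] (H →L[ℂ] H))

/-- The covariance relation; it makes the `σ(a) λ_s` a self-adjoint monoid. -/
theorem leftTranslation_mul_regularRep (s : Γ) (a : A) :
    leftTranslation Γ H s * regularRep α π a = regularRep α π (α s a) * leftTranslation Γ H s := by
  ext ξ t
  simp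

theorem regularRep_mem_reducedCrossedProduct {B : StarSubalgebra ℂ A} {b : A} (hb : b ∈ B) :
    regularRep α π b ∈ reducedCrossedProduct α π B :=
  StarSubalgebra.le_topologicalClosure _
    (StarAlgebra.subset_adjoin ℂ _ (Or.inl ⟨b, hb, rfl⟩))

theorem leftTranslation_mem_reducedCrossedProduct (B : StarSubalgebra ℂ A) (s : Γ) :
    leftTranslation Γ H s ∈ reducedCrossedProduct α π B :=
  StarSubalgebra.le_topologicalClosure _ (StarAlgebra.subset_adjoin ℂ _ (Or.inr ⟨s, rfl⟩))

theorem isClosed_reducedCrossedProduct (B : StarSubalgebra ℂ A) :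
    IsClosed (reducedCrossedProduct α π B : Set (L2 Γ H →L[ℂ] L2 Γ H)) :=
  StarSubalgebra.isClosed_topologicalClosure _

theorem reducedGroupCStar_le_reducedCrossedProduct (B : StarSubalgebra ℂ A) :
    reducedGroupCStar Γ H ≤ reducedCrossedProduct α π B :=
  reducedGroupCStar_le (isClosed_reducedCrossedProduct α π B)
    (leftTranslation_mem_reducedCrossedProduct α π B)

theorem reducedCrossedProduct_bot :
    reducedCrossedProduct α π ⊥ = reducedGroupCStar Γ H := by
  refine le_antisymm ?_ (reducedGroupCStar_le_reducedCrossedProduct α π ⊥)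
  refine StarSubalgebra.topologicalClosure_minimal (StarAlgebra.adjoin_le ?_)
    isClosed_reducedGroupCStar
  rintro _ (⟨b, hb, rfl⟩ | ⟨s, rfl⟩)
  · obtain ⟨c, rfl⟩ := Algebra.mem_bot.mp hb
    rw [AlgHomClass.commutes]
    exact algebraMap_mem _ c
  · exact leftTranslation_mem_reducedGroupCStar s

/-- The elements of `A ⋊_r Γ` lie in every closed subspace containing the `σ(a) λ_s`. -/
theorem reducedCrossedProduct_induction (V : Submodule ℂ (L2 Γ H →L[ℂ] L2 Γ H))
    (hV : IsClosed (V : Set (L2 Γ H →L[ℂ] L2 Γ H)))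
    (h : ∀ a s, regularRep α π a * leftTranslation Γ H s ∈ V)
    {x : L2 Γ H →L[ℂ] L2 Γ H} (hx : x ∈ reducedCrossedProduct α π ⊤) : x ∈ V := by
  let S : Submonoid (L2 Γ H →L[ℂ] L2 Γ H) :=
    { carrier := Set.range fun p : A × Γ => regularRep α π p.1 * leftTranslation Γ H p.2
      one_mem' := ⟨(1, 1), by simp⟩
      mul_mem' := by
        rintro _ _ ⟨⟨a, s⟩, rfl⟩ ⟨⟨b, t⟩, rfl⟩
        refine ⟨(a * α s b, s * t), ?_⟩
        simp only [map_mul, mul_assoc]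
        rw [← mul_assoc (leftTranslation Γ H s), leftTranslation_mul_regularRep]
        simp only [mul_assoc] }
  have hS : ∀ x ∈ S, star x ∈ S := by
    rintro _ ⟨⟨a, s⟩, rfl⟩
    refine ⟨(α s⁻¹ (star a), s⁻¹), ?_⟩
    simp only [star_mul, star_leftTranslation]
    rw [← map_star, leftTranslation_mul_regularRep]
  refine topologicalClosure_adjoin_induction S hS V hV ?_ (x := x) ?_
  · rintro _ ⟨⟨a, s⟩, rfl⟩
    exact h a s
  · refine StarSubalgebra.topologicalClosure_mono (StarAlgebra.adjoin_mono ?_) hx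
    rintro _ (⟨b, hb, rfl⟩ | ⟨s, rfl⟩)
    · exact ⟨(b, 1), by simp⟩
    · exact ⟨(1, s), by simp⟩

end

end

/-! ### Positivity and GNS compressions. -/

noncomputable section

open L2

section

open scoped CStarAlgebra

/-- An injective ⋆-homomorphism of C⋆-algebras reflects positivity. -/
theorem StarAlgHom.exists_eq_star_mul_self_of_injective {A B : Type*} [CStarAlgebra A]
    [CStarAlgebra B] [PartialOrder B] [StarOrderedRing B] (π : A →⋆ₐ[ℂ] B)
    (hπ : Function.Injective π) {a : A} (ha : 0 ≤ π a) : ∃ b, a = star b * b := by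
  let _ := CStarAlgebra.spectralOrder A
  have := CStarAlgebra.spectralOrderedRing A
  have hsa : IsSelfAdjoint a := by
    apply hπ
    rw [map_star, (IsSelfAdjoint.of_nonneg ha).star_eq]
  have hcont : Continuous π := (NonUnitalStarAlgHom.isometry π hπ).continuous
  -- The functional calculus commutes with `π`, so `π` sends the negative part of `a` to that of `π
  -- a`, which is zero.
  have hneg : a⁻ = 0 := by
    apply hπ
    rw [map_zero, CFC.negPart_def]
    have h1 := NonUnitalStarAlgHomClass.map_cfcₙ (S := ℂ) π (fun x : ℝ => x⁻) a
      (by fun_prop) (by simp) hcont hsa (IsSelfAdjoint.of_nonneg ha)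
    rw [h1, ← CFC.negPart_def, CFC.negPart_eq_zero_iff _ (IsSelfAdjoint.of_nonneg ha)]
    exact ha
  have h0 : 0 ≤ a := (CFC.negPart_eq_zero_iff a hsa).mp hneg
  exact CStarAlgebra.nonneg_iff_eq_star_mul_self.mp h0

end

/-- An orthonormal family induces an isometry from the space of square summable functions. -/
theorem Orthonormal.exists_linearIsometry {ι K : Type*} [NormedAddCommGroup K]
    [InnerProductSpace ℂ K] [CompleteSpace K] {v : ι → K} (hv : Orthonormal ℂ v) :
    ∃ V : L2 ι ℂ →ₗᵢ[ℂ] K, ∀ s, V (delta s 1) = v s := by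
  classical
  refine ⟨hv.orthogonalFamily.linearIsometry, fun s => ?_⟩
  have hd : (delta s (1 : ℂ) : L2 ι ℂ) = lp.single (E := fun _ : ι => ℂ) 2 s 1 := by
    ext s
    simp [delta_apply, lp.single_apply, Pi.single_apply]
  rw [hd, OrthogonalFamily.linearIsometry_apply_single]
  simp

section

variable {Γ : Type*} [Group Γ]

/-- A unitary representation of `Γ` in a C⋆-algebra `R` and a positive functional on `R` that
restricts to the canonical trace on `Γ` induce a bounded map from `R` to the operators on
`ℓ²(Γ)`. -/
theorem exists_clm_of_positive_functional {R : Type*} [CStarAlgebra R] (ψ : R →ₗ[ℂ] ℂ)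
    (hψ : ∀ x, 0 ≤ ψ (star x * x)) (U : Γ →* R) (hU : ∀ s, star (U s) = U s⁻¹)
    (h1 : ψ 1 = 1) (hne : ∀ s, s ≠ 1 → ψ (U s) = 0) :
    ∃ E : R →L[ℂ] (L2 Γ ℂ →L[ℂ] L2 Γ ℂ), (∀ x, E (star x) = star (E x)) ∧
      ∀ x s t, E x (delta s 1) t = ψ (U t⁻¹ * x * U s) := by
  let _ := CStarAlgebra.spectralOrder R
  have := CStarAlgebra.spectralOrderedRing R
  let f : R →ₚ[ℂ] ℂ := PositiveLinearMap.mk₀ ψ fun x hx => by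
    obtain ⟨y, rfl⟩ := CStarAlgebra.nonneg_iff_eq_star_mul_self.mp hx
    exact hψ y
  have hf : ∀ x, f x = ψ x := fun x => rfl
  let v : Γ → f.GNS := fun s => (f.toPreGNS (U s) : f.GNS)
  have hinner : ∀ x y : R, inner ℂ (f.toPreGNS x : f.GNS) (f.toPreGNS y : f.GNS)
      = ψ (star x * y) := by
    intro x y
    rw [UniformSpace.Completion.inner_coe, PositiveLinearMap.preGNS_inner_def]
    simp [hf]
  -- The inner product of `v s` and `v t` is `ψ(U(s⁻¹t))`, and `ψ` is the canonical trace on `Γ`.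
  -- The map `E` is then the GNS representation compressed to the span of the orbit `v`.
  have hv : Orthonormal ℂ v := by
    classical
    rw [orthonormal_iff_ite]
    intro s t
    rw [hinner, hU, ← map_mul]
    split_ifs with h
    · simp [h, h1]
    · exact hne _ (fun h' => h (inv_mul_eq_one.mp h'))
  obtain ⟨V₀, hV₀⟩ := hv.exists_linearIsometry
  let V : L2 Γ ℂ →L[ℂ] f.GNS := V₀.toContinuousLinearMap
  have hV : ∀ s, V (delta s 1) = v s := hV₀
  have hcont : Continuous f.gnsStarAlgHom :=
    AddMonoidHomClass.continuous_of_bound f.gnsStarAlgHom 1 fun x => by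
      rw [one_mul]; exact NonUnitalStarAlgHom.norm_apply_le _ x
  refine ⟨{ toFun := fun x => ContinuousLinearMap.adjoint V ∘L f.gnsStarAlgHom x ∘L V
            map_add' := fun x y => by ext; simp
            map_smul' := fun c x => by ext; simp
            cont := by fun_prop }, ?_, ?_⟩
  · intro x
    change ContinuousLinearMap.adjoint V ∘L f.gnsStarAlgHom (star x) ∘L V
      = star (ContinuousLinearMap.adjoint V ∘L f.gnsStarAlgHom x ∘L V)
    rw [map_star, ContinuousLinearMap.star_eq_adjoint, ContinuousLinearMap.star_eq_adjoint,
      ContinuousLinearMap.adjoint_comp, ContinuousLinearMap.adjoint_comp,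
      ContinuousLinearMap.adjoint_adjoint, ContinuousLinearMap.comp_assoc]
  intro x s t
  have : (ContinuousLinearMap.adjoint V ∘L f.gnsStarAlgHom x ∘L V) (delta s 1) t
      = inner ℂ (delta t (1 : ℂ))
        ((ContinuousLinearMap.adjoint V ∘L f.gnsStarAlgHom x ∘L V) (delta s 1)) := by
    simp
  change (ContinuousLinearMap.adjoint V ∘L f.gnsStarAlgHom x ∘L V) (delta s 1) t = _
  rw [this]
  simp only [ContinuousLinearMap.comp_apply]
  rw [ContinuousLinearMap.adjoint_inner_right, hV, hV, ← hU]
  have h2 : f.gnsStarAlgHom x (v s) = (f.toPreGNS (x * U s) : f.GNS) :=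
    f.gnsNonUnitalStarAlgHom_apply_coe
  rw [h2, hinner, mul_assoc]

end

/-! ### The canonical expectation of `A ⋊_r Γ` onto `A`. -/

section

variable {Γ : Type*} [Group Γ] {H : Type*} [NormedAddCommGroup H] [InnerProductSpace ℂ H]

/-- The compression of an operator on `ℓ²(Γ, H)` to the copy of `H` at the identity of `Γ`. -/
def compress : (L2 Γ H →L[ℂ] L2 Γ H) →L[ℂ] (H →L[ℂ] H) where
  toFun x := coord 1 ∘L x ∘L delta 1
  map_add' x y := by ext; simp
  map_smul' c x := by ext; simp
  cont := by fun_prop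

@[simp] theorem compress_apply (x : L2 Γ H →L[ℂ] L2 Γ H) (h : H) :
    compress x h = x (delta 1 h) 1 := rfl

theorem compress_leftTranslation {s : Γ} (hs : s ≠ 1) :
    compress (leftTranslation Γ H s) = 0 := by
  ext h
  simp only [compress_apply, leftTranslation_delta, mul_one]
  exact delta_apply_ne (Ne.symm hs) h

variable [CompleteSpace H]

theorem compress_star_mul_self (x : L2 Γ H →L[ℂ] L2 Γ H) :
    compress (star x * x)
      = ContinuousLinearMap.adjoint (x ∘L delta 1) ∘L (x ∘L delta 1) := by
  ext h
  rw [ContinuousLinearMap.adjoint_comp, adjoint_delta]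
  rfl

variable {A : Type*} [CStarAlgebra A] (α : Γ →* (A ≃⋆ₐ[ℂ] A)) (π : A →⋆ₐ[ℂ] (H →L[ℂ] H))

theorem compress_regularRep_mul_leftTranslation {s : Γ} (hs : s ≠ 1) (a : A) :
    compress (regularRep α π a * leftTranslation Γ H s) = 0 := by
  ext h
  simp [delta_apply_ne (Ne.symm hs) h]

@[simp] theorem compress_regularRep (a : A) : compress (regularRep α π a) = π a := by
  ext h
  simp

/-- Compression kills `σ(a) λ_s` for `s ≠ 1` and sends `σ(a)` to `π a`; the range of `π` is closed
because an injective ⋆-homomorphism is isometric. -/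
theorem compress_mem_range {π : A →⋆ₐ[ℂ] (H →L[ℂ] H)} (hπ : Function.Injective π)
    {x : L2 Γ H →L[ℂ] L2 Γ H} (hx : x ∈ reducedCrossedProduct α π ⊤) :
    ∃ a, π a = compress x := by
  let W : Submodule ℂ (H →L[ℂ] H) := LinearMap.range (π : A →ₗ[ℂ] (H →L[ℂ] H))
  have hW : IsClosed (W : Set (H →L[ℂ] H)) := by
    have : (W : Set (H →L[ℂ] H)) = Set.range π := rfl
    rw [this]
    exact (NonUnitalStarAlgHom.isometry π hπ).isClosedEmbedding.isClosed_range
  refine reducedCrossedProduct_induction α π (W.comap (compress (Γ := Γ) (H := H)).toLinearMap)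
    (hW.preimage compress.continuous) ?_ hx
  intro a s
  by_cases hs : s = 1
  · exact ⟨a, by simp [hs]⟩
  · exact ⟨0, by simpa using (compress_regularRep_mul_leftTranslation α π hs a).symm⟩

/-- The canonical expectation `A ⋊_r Γ → A`. -/
def canonicalExpectation {π : A →⋆ₐ[ℂ] (H →L[ℂ] H)} (hπ : Function.Injective π) :
    reducedCrossedProduct α π ⊤ →ₗ[ℂ] A where
  toFun x := (compress_mem_range α hπ x.2).choose
  map_add' x y := by
    apply hπ
    rw [map_add, (compress_mem_range α hπ (x + y).2).choose_spec,
      (compress_mem_range α hπ x.2).choose_spec, (compress_mem_range α hπ y.2).choose_spec]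
    simp
  map_smul' c x := by
    apply hπ
    rw [RingHom.id_apply, map_smul, (compress_mem_range α hπ (c • x).2).choose_spec,
      (compress_mem_range α hπ x.2).choose_spec]
    simp

theorem map_canonicalExpectation {π : A →⋆ₐ[ℂ] (H →L[ℂ] H)} (hπ : Function.Injective π)
    (x : reducedCrossedProduct α π ⊤) :
    π (canonicalExpectation α hπ x) = compress (x : L2 Γ H →L[ℂ] L2 Γ H) :=
  (compress_mem_range α hπ x.2).choose_spec

end

end

/-! ### The conditional expectation onto `C⋆_r(Γ)`. -/

noncomputable section

open L2

theorem L2.clm_ext_complex {Γ : Type*} {x y : L2 Γ ℂ →L[ℂ] L2 Γ ℂ}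
    (h : ∀ s t, x (delta s 1) t = y (delta s 1) t) : x = y := by
  refine clm_ext fun s v => ?_
  have hv : (delta s v : L2 Γ ℂ) = v • delta s 1 := by
    rw [← map_smul, smul_eq_mul, mul_one]
  rw [hv, map_smul, map_smul]
  congr 1
  ext t
  exact h s t

variable {Γ : Type*} [Group Γ] {H : Type*} [NormedAddCommGroup H] [InnerProductSpace ℂ H]
  [CompleteSpace H] {A : Type*} [CStarAlgebra A]

/-- The translations as elements of the reduced crossed product. -/
def crossedTranslation (α : Γ →* (A ≃⋆ₐ[ℂ] A)) (π : A →⋆ₐ[ℂ] (H →L[ℂ] H)) :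
    Γ →* reducedCrossedProduct α π ⊤ :=
  (leftTranslation Γ H).codRestrict (reducedCrossedProduct α π ⊤)
    (leftTranslation_mem_reducedCrossedProduct α π ⊤)

/-- The embedding of the coefficient algebra into the reduced crossed product. -/
def crossedRep (α : Γ →* (A ≃⋆ₐ[ℂ] A)) (π : A →⋆ₐ[ℂ] (H →L[ℂ] H)) :
    A →⋆ₐ[ℂ] reducedCrossedProduct α π ⊤ :=
  (regularRep α π).codRestrict (reducedCrossedProduct α π ⊤)
    fun _ => regularRep_mem_reducedCrossedProduct α π trivial

variable (α : Γ →* (A ≃⋆ₐ[ℂ] A)) (π : A →⋆ₐ[ℂ] (H →L[ℂ] H))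

theorem star_crossedTranslation (s : Γ) :
    star (crossedTranslation α π s) = crossedTranslation α π s⁻¹ :=
  Subtype.ext (star_leftTranslation s)

theorem crossedTranslation_mul_crossedRep (s : Γ) (a : A) :
    crossedTranslation α π s * crossedRep α π a
      = crossedRep α π (α s a) * crossedTranslation α π s :=
  Subtype.ext (leftTranslation_mul_regularRep α π s a)

theorem star_mul_self_mul_crossedTranslation (x : reducedCrossedProduct α π ⊤) (s : Γ) :
    star (x * crossedTranslation α π s) * (x * crossedTranslation α π s)
      = crossedTranslation α π s⁻¹ * ((star x * x) * crossedTranslation α π s) := by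
  rw [star_mul, star_crossedTranslation]
  simp only [mul_assoc]

/-- `E` is the conditional expectation `A ⋊_r Γ → C⋆_r(Γ)` attached to the faithful invariant
state `φ`, with values realized as operators on `ℓ²(Γ)`. -/
structure IsGroupExpectation (φ : A →ₗ[ℂ] ℂ)
    (E : reducedCrossedProduct α π ⊤ →L[ℂ] (L2 Γ ℂ →L[ℂ] L2 Γ ℂ)) : Prop where
  map_star : ∀ x, E (star x) = star (E x)
  translation_mul : ∀ s x, E (crossedTranslation α π s * x) = leftTranslation Γ ℂ s * E x
  mul_translation : ∀ s x, E (x * crossedTranslation α π s) = E x * leftTranslation Γ ℂ s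
  map_one : E 1 = 1
  map_rep : ∀ a, E (crossedRep α π a) = φ a • 1
  faithful : ∀ x, E (star x * x) = 0 → x = 0

/-- The state `φ` composed with the canonical expectation restricts to the canonical trace on the
translations, so GNS compression produces `E`. Invariance of `φ` makes the diagonal of `E(σ(a))`
constant. -/
theorem exists_isGroupExpectation {φ : A →ₗ[ℂ] ℂ} (hφ : IsFaithfulInvariantState α φ)
    (hπ : Function.Injective π) : ∃ E, IsGroupExpectation α π φ E := by
  have := isClosed_reducedCrossedProduct α π ⊤
  let ψ : reducedCrossedProduct α π ⊤ →ₗ[ℂ] ℂ := φ ∘ₗ canonicalExpectation α hπ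
  have hψ1 : ∀ (x : reducedCrossedProduct α π ⊤) (a : A),
      compress (x : L2 Γ H →L[ℂ] L2 Γ H) = π a → ψ x = φ a := by
    intro x a h
    change φ (canonicalExpectation α hπ x) = φ a
    congr 1
    apply hπ
    rw [map_canonicalExpectation, h]
  have hpos : ∀ x : reducedCrossedProduct α π ⊤,
      ∃ b, canonicalExpectation α hπ (star x * x) = star b * b := by
    intro x
    refine StarAlgHom.exists_eq_star_mul_self_of_injective π hπ ?_
    rw [map_canonicalExpectation]
    change 0 ≤ compress (star (x : L2 Γ H →L[ℂ] L2 Γ H) * (x : L2 Γ H →L[ℂ] L2 Γ H))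
    rw [compress_star_mul_self, ContinuousLinearMap.nonneg_iff_isPositive]
    exact ContinuousLinearMap.isPositive_adjoint_comp_self _
  have hcoef : ∀ a s, s ≠ 1 → ψ (crossedRep α π a * crossedTranslation α π s) = 0 := by
    intro a s hs
    rw [← map_zero φ]
    refine hψ1 _ _ ?_
    rw [map_zero]
    exact compress_regularRep_mul_leftTranslation α π hs a
  have hrep : ∀ a, ψ (crossedRep α π a) = φ a := fun a => hψ1 _ _ (compress_regularRep α π a)
  obtain ⟨E, hstar, hE⟩ := exists_clm_of_positive_functional ψ
    (fun x => by
      obtain ⟨b, hb⟩ := hpos x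
      change 0 ≤ φ (canonicalExpectation α hπ (star x * x))
      rw [hb]
      exact hφ.nonneg b)
    (crossedTranslation α π) (star_crossedTranslation α π)
    (by rw [← map_one (crossedRep α π), hrep, hφ.map_one])
    (fun s hs => by simpa using hcoef 1 s hs)
  have hmul : ∀ s x, E (x * crossedTranslation α π s) = E x * leftTranslation Γ ℂ s := by
    intro s x
    refine clm_ext_complex fun r t => ?_
    rw [hE, mul_apply_eq_comp, leftTranslation_delta, hE, map_mul (crossedTranslation α π)]
    simp only [mul_assoc]
  have hmul' : ∀ s x, E (crossedTranslation α π s * x) = leftTranslation Γ ℂ s * E x := by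
    intro s x
    have := hmul s⁻¹ (star x)
    rw [← star_crossedTranslation, ← star_mul, hstar, hstar, ← star_leftTranslation,
      ← star_mul] at this
    exact star_injective this
  have hErep : ∀ a, E (crossedRep α π a) = φ a • 1 := by
    intro a
    refine clm_ext_complex fun s t => ?_
    rw [hE, crossedTranslation_mul_crossedRep, mul_assoc, ← map_mul]
    by_cases h : t = s
    · subst h
      have := hφ.invariant t⁻¹ a
      simpa [hrep] using this
    · rw [hcoef _ _ (fun h' => h (inv_mul_eq_one.mp h'))]
      simp [delta_apply_ne h]
  refine ⟨E, hstar, hmul', hmul, ?_, hErep, ?_⟩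
  · rw [← map_one (crossedRep α π), hErep, hφ.map_one, one_smul]
  · intro x hx
    -- The coefficient of `E(y⋆y)` at the identity is `φ` of the canonical expectation of `y⋆y`.
    -- Faithfulness of `φ` kills that expectation, so `y` vanishes on `δ_1 ⊗ H`; applying this to `x
    -- λ_s` covers `δ_s ⊗ H`.
    have key : ∀ y : reducedCrossedProduct α π ⊤, E (star y * y) = 0 →
        (y : L2 Γ H →L[ℂ] L2 Γ H) ∘L delta 1 = 0 := by
      intro y hy
      have h1 := hE (star y * y) 1 1
      rw [hy] at h1
      simp only [inv_one, map_one, one_mul, mul_one] at h1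
      obtain ⟨b, hb⟩ := hpos y
      change _ = φ (canonicalExpectation α hπ (star y * y)) at h1
      rw [hb] at h1
      have hb0 : b = 0 := hφ.faithful b (by rw [← h1]; simp)
      have h2 := map_canonicalExpectation α hπ (star y * y)
      rw [hb, hb0, star_zero, zero_mul, map_zero] at h2
      change 0 = compress (star (y : L2 Γ H →L[ℂ] L2 Γ H) * (y : L2 Γ H →L[ℂ] L2 Γ H)) at h2
      rw [compress_star_mul_self] at h2
      exact (ContinuousLinearMap.adjoint_comp_self_eq_zero_iff).mp h2.symm
    refine Subtype.ext (clm_ext fun s v => ?_)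
    have h3 := key (x * crossedTranslation α π s) (by
      rw [star_mul_self_mul_crossedTranslation, hmul', hmul, hx, zero_mul, mul_zero])
    have h4 : (x : L2 Γ H →L[ℂ] L2 Γ H) (leftTranslation Γ H s (delta 1 v)) = 0 :=
      congrArg (fun T : H →L[ℂ] L2 Γ H => T v) h3
    rw [leftTranslation_delta, mul_one] at h4
    exact h4

/-- Lets closed subspaces of the crossed product serve as closed subspaces of the ambient operator
algebra, where the induction principles are stated. -/
theorem Submodule.isClosed_map_subtype_of_isClosed {R : Type*} [CStarAlgebra R]
    {S : StarSubalgebra ℂ R} (hS : IsClosed (S : Set R)) {V : Submodule ℂ S}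
    (hV : IsClosed (V : Set S)) :
    IsClosed (V.map (S.subtype : S →ₗ[ℂ] R) : Set R) := by
  rw [Submodule.map_coe]
  exact hS.isClosedEmbedding_subtypeVal.isClosedMap _ hV

theorem crossedProduct_induction {V : Submodule ℂ (reducedCrossedProduct α π ⊤)}
    (hV : IsClosed (V : Set (reducedCrossedProduct α π ⊤)))
    (h : ∀ a s, crossedRep α π a * crossedTranslation α π s ∈ V)
    (x : reducedCrossedProduct α π ⊤) : x ∈ V := by
  obtain ⟨y, hy, hyx⟩ := reducedCrossedProduct_induction α π _
    (Submodule.isClosed_map_subtype_of_isClosed (isClosed_reducedCrossedProduct α π ⊤) hV)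
    (fun a s => ⟨_, h a s, rfl⟩) x.2
  rwa [← Subtype.ext hyx]

theorem crossedProduct_induction_group {V : Submodule ℂ (reducedCrossedProduct α π ⊤)}
    (hV : IsClosed (V : Set (reducedCrossedProduct α π ⊤)))
    (h : ∀ s, crossedTranslation α π s ∈ V) {x : reducedCrossedProduct α π ⊤}
    (hx : (x : L2 Γ H →L[ℂ] L2 Γ H) ∈ reducedGroupCStar Γ H) : x ∈ V := by
  obtain ⟨y, hy, hyx⟩ := reducedGroupCStar_induction _
    (Submodule.isClosed_map_subtype_of_isClosed (isClosed_reducedCrossedProduct α π ⊤) hV)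
    (fun s => ⟨_, h s, rfl⟩) hx
  rwa [← Subtype.ext hyx]

namespace IsGroupExpectation

variable {α π} {φ : A →ₗ[ℂ] ℂ} {E : reducedCrossedProduct α π ⊤ →L[ℂ] (L2 Γ ℂ →L[ℂ] L2 Γ ℂ)}

/-- The identity is closed and linear in `y`, and for translations it is the module property of `E`.
-/
theorem map_mul_of_mem_right (hE : IsGroupExpectation α π φ E)
    (x : reducedCrossedProduct α π ⊤) {y : reducedCrossedProduct α π ⊤}
    (hy : (y : L2 Γ H →L[ℂ] L2 Γ H) ∈ reducedGroupCStar Γ H) : E (x * y) = E x * E y := by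
  let V : Submodule ℂ (reducedCrossedProduct α π ⊤) :=
    { carrier := {y | E (x * y) = E x * E y}
      add_mem' := fun {a b} (ha : _ = _) (hb : _ = _) => by
        change E (x * (a + b)) = E x * E (a + b)
        rw [mul_add, map_add, map_add, mul_add, ha, hb]
      zero_mem' := by simp
      smul_mem' := fun c a (ha : _ = _) => by
        change E (x * (c • a)) = E x * E (c • a)
        rw [mul_smul_comm, map_smul, map_smul, mul_smul_comm, ha] }
  have hV : IsClosed (V : Set (reducedCrossedProduct α π ⊤)) :=
    isClosed_eq (E.continuous.comp (continuous_const.mul continuous_id))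
      (continuous_const.mul E.continuous)
  refine crossedProduct_induction_group α π hV (fun s => ?_) hy
  change E (x * crossedTranslation α π s) = E x * E (crossedTranslation α π s)
  have h1 : E (crossedTranslation α π s) = leftTranslation Γ ℂ s := by
    rw [← one_mul (crossedTranslation α π s), hE.mul_translation, hE.map_one, one_mul]
  rw [hE.mul_translation, h1]

theorem apply_mem (hE : IsGroupExpectation α π φ E)
    (x : reducedCrossedProduct α π ⊤) : E x ∈ reducedGroupCStar Γ ℂ := by
  refine crossedProduct_induction α π
    (V := (Subalgebra.toSubmodule (reducedGroupCStar Γ ℂ).toSubalgebra).comap E.toLinearMap)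
    (isClosed_reducedGroupCStar.preimage E.continuous) (fun a s => ?_) x
  change E (crossedRep α π a * crossedTranslation α π s) ∈ reducedGroupCStar Γ ℂ
  rw [hE.mul_translation, hE.map_rep, smul_mul_assoc, one_mul]
  exact SMulMemClass.smul_mem _ (leftTranslation_mem_reducedGroupCStar s)

end IsGroupExpectation

end

/-! ### Multiplicative domains modulo an ideal. -/

noncomputable section

open L2

/-- `J` is a proper closed selfadjoint two-sided ideal of `C⋆_r(Γ)`. -/
structure IsProperClosedIdeal {Γ : Type*} [Group Γ] (J : Submodule ℂ (L2 Γ ℂ →L[ℂ] L2 Γ ℂ)) :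
    Prop where
  isClosed : IsClosed (J : Set (L2 Γ ℂ →L[ℂ] L2 Γ ℂ))
  mem_reducedGroupCStar : ∀ {x}, x ∈ J → x ∈ reducedGroupCStar Γ ℂ
  mul_mem_left : ∀ {x y}, x ∈ reducedGroupCStar Γ ℂ → y ∈ J → x * y ∈ J
  star_mem : ∀ {x}, x ∈ J → star x ∈ J
  one_notMem : (1 : L2 Γ ℂ →L[ℂ] L2 Γ ℂ) ∉ J

theorem IsProperClosedIdeal.mul_mem_right {Γ : Type*} [Group Γ]
    {J : Submodule ℂ (L2 Γ ℂ →L[ℂ] L2 Γ ℂ)} (hJ : IsProperClosedIdeal J)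
    {x y : L2 Γ ℂ →L[ℂ] L2 Γ ℂ} (hx : x ∈ J) (hy : y ∈ reducedGroupCStar Γ ℂ) : x * y ∈ J := by
  have := hJ.star_mem (hJ.mul_mem_left (StarMemClass.star_mem hy) (hJ.star_mem hx))
  simpa using this

variable {Γ : Type*} [Group Γ] {H : Type*} [NormedAddCommGroup H] [InnerProductSpace ℂ H]
  [CompleteSpace H] {A : Type*} [CStarAlgebra A] {α : Γ →* (A ≃⋆ₐ[ℂ] A)}
  {π : A →⋆ₐ[ℂ] (H →L[ℂ] H)} {φ : A →ₗ[ℂ] ℂ}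
  {E : reducedCrossedProduct α π ⊤ →L[ℂ] (L2 Γ ℂ →L[ℂ] L2 Γ ℂ)}
  {J : Submodule ℂ (L2 Γ ℂ →L[ℂ] L2 Γ ℂ)}

theorem IsGroupExpectation.map_mul_of_mem_left (hE : IsGroupExpectation α π φ E)
    {x : reducedCrossedProduct α π ⊤} (hx : (x : L2 Γ H →L[ℂ] L2 Γ H) ∈ reducedGroupCStar Γ H)
    (y : reducedCrossedProduct α π ⊤) : E (x * y) = E x * E y := by
  apply star_injective
  rw [← hE.map_star, star_mul, hE.map_mul_of_mem_right _ (star_mem hx), hE.map_star, hE.map_star,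
    star_mul]

theorem IsGroupExpectation.map_translation (hE : IsGroupExpectation α π φ E) (s : Γ) :
    E (crossedTranslation α π s) = leftTranslation Γ ℂ s := by
  rw [← one_mul (crossedTranslation α π s), hE.mul_translation, hE.map_one, one_mul]

/-- The multiplicative domain of the composition of a unital ⋆-linear map `E` with the quotient map
by a subspace `J` that is an ideal relative to the range of `E`. -/
def LinearMap.multiplicativeDomain {R M : Type*} [Ring R] [StarRing R] [Algebra ℂ R]
    [StarModule ℂ R] [Ring M] [StarRing M] [Algebra ℂ M] [StarModule ℂ M] (E : R →ₗ[ℂ] M)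
    (J : Submodule ℂ M) (h1 : E 1 = 1) (hstar : ∀ x, E (star x) = star (E x))
    (hleft : ∀ x, ∀ y ∈ J, E x * y ∈ J) (hright : ∀ x, ∀ y ∈ J, y * E x ∈ J)
    (hJstar : ∀ x ∈ J, star x ∈ J) : StarSubalgebra ℂ R where
  carrier := {d | ∀ x, E (x * d) - E x * E d ∈ J ∧ E (d * x) - E d * E x ∈ J}
  -- The defect of a product telescopes into defects of `d` and `e`, multiplied by values of `E`,
  -- under which `J` is stable.
  mul_mem' := by
    intro d e hd he x
    constructor
    · have h : E (x * (d * e)) - E x * E (d * e) = (E (x * d * e) - E (x * d) * E e)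
          + (E (x * d) - E x * E d) * E e - E x * (E (d * e) - E d * E e) := by
        rw [← mul_assoc x d e]
        noncomm_ring
      rw [h]
      exact J.sub_mem (J.add_mem (he _).1 (hright _ _ (hd _).1)) (hleft _ _ (he _).1)
    · have h : E (d * e * x) - E (d * e) * E x = (E (d * (e * x)) - E d * E (e * x))
          + E d * (E (e * x) - E e * E x) - (E (d * e) - E d * E e) * E x := by
        rw [mul_assoc d e x]
        noncomm_ring
      rw [h]
      exact J.sub_mem (J.add_mem (hd _).2 (hleft _ _ (he _).2)) (hright _ _ (he _).1)
  add_mem' := by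
    intro d e hd he x
    constructor
    · have h : E (x * (d + e)) - E x * E (d + e)
          = (E (x * d) - E x * E d) + (E (x * e) - E x * E e) := by
        rw [mul_add, map_add, map_add]
        noncomm_ring
      rw [h]
      exact J.add_mem (hd x).1 (he x).1
    · have h : E ((d + e) * x) - E (d + e) * E x
          = (E (d * x) - E d * E x) + (E (e * x) - E e * E x) := by
        rw [add_mul, map_add, map_add]
        noncomm_ring
      rw [h]
      exact J.add_mem (hd x).2 (he x).2
  algebraMap_mem' := by
    intro c x
    simp [Algebra.algebraMap_eq_smul_one, h1]
  star_mem' := by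
    intro d hd x
    have h1 := hJstar _ (hd (star x)).1
    have h2 := hJstar _ (hd (star x)).2
    rw [star_sub, star_mul, ← hstar, ← hstar, ← hstar, star_mul, star_star] at h1 h2
    exact ⟨h2, h1⟩

/-- The multiplicative domain of the composition of the expectation `A ⋊_r Γ → C⋆_r(Γ)` with the
quotient map by the ideal `J`. -/
def multiplicativeDomain (hE : IsGroupExpectation α π φ E) (hJ : IsProperClosedIdeal J) :
    StarSubalgebra ℂ (reducedCrossedProduct α π ⊤) :=
  E.toLinearMap.multiplicativeDomain J hE.map_one hE.map_star
    (fun x _ hy => hJ.mul_mem_left (hE.apply_mem x) hy)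
    (fun x _ hy => hJ.mul_mem_right hy (hE.apply_mem x)) (fun _ hx => hJ.star_mem hx)

theorem mem_multiplicativeDomain (hE : IsGroupExpectation α π φ E) (hJ : IsProperClosedIdeal J)
    {d : reducedCrossedProduct α π ⊤} : d ∈ multiplicativeDomain hE hJ ↔
      ∀ x, E (x * d) - E x * E d ∈ J ∧ E (d * x) - E d * E x ∈ J := Iff.rfl

theorem isClosed_multiplicativeDomain (hE : IsGroupExpectation α π φ E)
    (hJ : IsProperClosedIdeal J) :
    IsClosed (multiplicativeDomain hE hJ : Set (reducedCrossedProduct α π ⊤)) := by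
  have h : (multiplicativeDomain hE hJ : Set (reducedCrossedProduct α π ⊤))
      = ⋂ x, {d | E (x * d) - E x * E d ∈ J} ∩ {d | E (d * x) - E d * E x ∈ J} := by
    ext d
    simp only [SetLike.mem_coe, mem_multiplicativeDomain, Set.mem_iInter, Set.mem_inter_iff,
      Set.mem_ofPred_eq]
  rw [h]
  refine isClosed_iInter fun x => IsClosed.inter (hJ.isClosed.preimage ?_)
    (hJ.isClosed.preimage ?_)
  · exact (E.continuous.comp (continuous_const.mul continuous_id)).sub
      (continuous_const.mul E.continuous)
  · exact (E.continuous.comp (continuous_id.mul continuous_const)).sub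
      (E.continuous.mul continuous_const)

theorem crossedTranslation_mem_multiplicativeDomain (hE : IsGroupExpectation α π φ E)
    (hJ : IsProperClosedIdeal J) (s : Γ) :
    crossedTranslation α π s ∈ multiplicativeDomain hE hJ := by
  refine (mem_multiplicativeDomain hE hJ).mpr fun x => ?_
  rw [hE.mul_translation, hE.translation_mul, hE.map_translation, sub_self, sub_self]
  exact ⟨J.zero_mem, J.zero_mem⟩

/-- Since `E` is a bimodule map over `C⋆_r(Γ)`, `E(v y)` and `E(x v)` lie in `J` for every `v`, so
all four terms of the two defects lie in `J` separately. -/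
theorem mul_mul_mem_multiplicativeDomain (hE : IsGroupExpectation α π φ E)
    (hJ : IsProperClosedIdeal J) {x y : reducedCrossedProduct α π ⊤}
    (hx : (x : L2 Γ H →L[ℂ] L2 Γ H) ∈ reducedGroupCStar Γ H)
    (hy : (y : L2 Γ H →L[ℂ] L2 Γ H) ∈ reducedGroupCStar Γ H) (hxJ : E x ∈ J) (hyJ : E y ∈ J)
    (z : reducedCrossedProduct α π ⊤) : x * z * y ∈ multiplicativeDomain hE hJ := by
  refine (mem_multiplicativeDomain hE hJ).mpr fun w => ?_
  have h1 : ∀ v, E (v * y) ∈ J := fun v => by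
    rw [hE.map_mul_of_mem_right v hy]
    exact hJ.mul_mem_left (hE.apply_mem v) hyJ
  have h2 : ∀ v, E (x * v) ∈ J := fun v => by
    rw [hE.map_mul_of_mem_left hx v]
    exact hJ.mul_mem_right hxJ (hE.apply_mem v)
  constructor
  · refine J.sub_mem ?_ (hJ.mul_mem_left (hE.apply_mem w) (h1 _))
    rw [← mul_assoc]
    exact h1 _
  · refine J.sub_mem ?_ (hJ.mul_mem_right (h1 _) (hE.apply_mem w))
    rw [mul_assoc, mul_assoc]
    exact h2 _

/-- Testing the defect of `σ(b)` against `σ(b)⋆` gives the variance of `b` under `φ` times `1`. A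
proper ideal contains no nonzero scalar, so the variance vanishes. -/
theorem crossedRep_mem_multiplicativeDomain (hφ : IsFaithfulInvariantState α φ)
    (hE : IsGroupExpectation α π φ E) (hJ : IsProperClosedIdeal J) {b : A}
    (hb : crossedRep α π b ∈ multiplicativeDomain hE hJ) : b = algebraMap ℂ A (φ b) := by
  have h1 := ((mem_multiplicativeDomain hE hJ).mp hb (star (crossedRep α π b))).1
  rw [← map_star (crossedRep α π), ← map_mul (crossedRep α π), hE.map_rep, hE.map_rep, hE.map_rep,
    smul_mul_smul_comm, one_mul, ← sub_smul] at h1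
  have h2 : φ (star b * b) - φ (star b) * φ b = 0 := by
    by_contra hne
    apply hJ.one_notMem
    have := J.smul_mem (φ (star b * b) - φ (star b) * φ b)⁻¹ h1
    rwa [smul_smul, inv_mul_cancel₀ hne, one_smul] at this
  have h3 := hφ.faithful (b - φ b • 1) (by
    rw [star_sub, star_smul, star_one, sub_mul, mul_sub, mul_sub, smul_mul_assoc, one_mul,
      mul_smul_comm, mul_one, smul_mul_smul_comm, one_mul, map_sub, map_sub, map_sub, map_smul,
      map_smul, map_smul, hφ.map_one, smul_eq_mul, smul_eq_mul, smul_eq_mul]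
    linear_combination h2)
  rw [Algebra.algebraMap_eq_smul_one]
  exact sub_eq_zero.mp h3

/-- If the products `x σ(a) y` with `x` and `y` in the ideal `J` do not all lie in `C⋆_r(Γ)`, then
the multiplicative domain is an intermediate algebra that is not a crossed product. -/
theorem exists_intermediate_of_ideal (hφ : IsFaithfulInvariantState α φ)
    (hE : IsGroupExpectation α π φ E) (hJ : IsProperClosedIdeal J)
    (hJA : ¬ ∀ x y : reducedCrossedProduct α π ⊤,
      (x : L2 Γ H →L[ℂ] L2 Γ H) ∈ reducedGroupCStar Γ H →
      (y : L2 Γ H →L[ℂ] L2 Γ H) ∈ reducedGroupCStar Γ H → E x ∈ J → E y ∈ J → ∀ a,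
      (x : L2 Γ H →L[ℂ] L2 Γ H) * regularRep α π a * (y : L2 Γ H →L[ℂ] L2 Γ H)
        ∈ reducedGroupCStar Γ H) :
    ∃ D : StarSubalgebra ℂ (L2 Γ H →L[ℂ] L2 Γ H),
      IsClosed (D : Set (L2 Γ H →L[ℂ] L2 Γ H)) ∧ reducedGroupCStar Γ H ≤ D ∧
      D ≤ reducedCrossedProduct α π ⊤ ∧ ¬ IsSubCrossedProduct α π D ∧
      D ⊓ (regularRep α π).range = ⊥ := by
  let D : StarSubalgebra ℂ (L2 Γ H →L[ℂ] L2 Γ H) :=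
    (multiplicativeDomain hE hJ).map (reducedCrossedProduct α π ⊤).subtype
  have hmem : ∀ d : reducedCrossedProduct α π ⊤, (d : L2 Γ H →L[ℂ] L2 Γ H) ∈ D ↔
      d ∈ multiplicativeDomain hE hJ := by
    intro d
    refine ⟨?_, fun h => ⟨d, h, rfl⟩⟩
    rintro ⟨e, he, hed⟩
    rwa [← Subtype.ext hed]
  have hclosed : IsClosed (D : Set (L2 Γ H →L[ℂ] L2 Γ H)) :=
    (isClosed_reducedCrossedProduct α π ⊤).isClosedEmbedding_subtypeVal.isClosedMap _
      (isClosed_multiplicativeDomain hE hJ)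
  have hle : D ≤ reducedCrossedProduct α π ⊤ := by
    rintro _ ⟨e, he, rfl⟩
    exact e.2
  have hgroup : reducedGroupCStar Γ H ≤ D := reducedGroupCStar_le hclosed fun s =>
    (hmem (crossedTranslation α π s)).mpr (crossedTranslation_mem_multiplicativeDomain hE hJ s)
  have hrep : ∀ b, regularRep α π b ∈ D → b ∈ (⊥ : StarSubalgebra ℂ A) := by
    intro b hb
    rw [crossedRep_mem_multiplicativeDomain hφ hE hJ ((hmem (crossedRep α π b)).mp hb)]
    exact algebraMap_mem _ _
  refine ⟨D, hclosed, hgroup, hle, ?_, ?_⟩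
  · rintro ⟨B, -, -, hDB⟩
    have hB : B = ⊥ := by
      refine le_bot_iff.mp fun b hb => hrep b ?_
      rw [hDB]
      exact regularRep_mem_reducedCrossedProduct α π hb
    rw [hB, reducedCrossedProduct_bot] at hDB
    refine hJA fun x y hx hy hxJ hyJ a => ?_
    rw [← hDB]
    exact (hmem (x * crossedRep α π a * y)).mpr
      (mul_mul_mem_multiplicativeDomain hE hJ hx hy hxJ hyJ _)
  · refine le_bot_iff.mp ?_
    rintro _ ⟨hd, b, rfl⟩
    obtain ⟨c, rfl⟩ := Algebra.mem_bot.mp (hrep b hd)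
    change regularRep α π (algebraMap ℂ A c) ∈ _
    rw [AlgHomClass.commutes]
    exact algebraMap_mem _ c

end

/-! ### Ideals from functionals and from normal subgroups. -/

noncomputable section

open L2

section

variable {Γ : Type*} [Group Γ]

/-- The ideal of `C⋆_r(Γ)` attached to a bounded functional: the kernel of its GNS
representation. -/
def functionalIdeal (f : (L2 Γ ℂ →L[ℂ] L2 Γ ℂ) →L[ℂ] ℂ) : Submodule ℂ (L2 Γ ℂ →L[ℂ] L2 Γ ℂ) where
  carrier := {x | x ∈ reducedGroupCStar Γ ℂ ∧ ∀ s t,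
    f (leftTranslation Γ ℂ s * x * leftTranslation Γ ℂ t) = 0 ∧
    f (leftTranslation Γ ℂ s * star x * leftTranslation Γ ℂ t) = 0}
  zero_mem' := ⟨zero_mem _, by simp⟩
  add_mem' := by
    rintro x y ⟨hx, hx'⟩ ⟨hy, hy'⟩
    exact ⟨add_mem hx hy, fun s t => by
      simp [mul_add, add_mul, hx' s t, hy' s t]⟩
  smul_mem' := by
    rintro c x ⟨hx, hx'⟩
    exact ⟨SMulMemClass.smul_mem c hx, fun s t => by simp [hx' s t]⟩

theorem mem_functionalIdeal {f : (L2 Γ ℂ →L[ℂ] L2 Γ ℂ) →L[ℂ] ℂ} {x : L2 Γ ℂ →L[ℂ] L2 Γ ℂ} :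
    x ∈ functionalIdeal f ↔ x ∈ reducedGroupCStar Γ ℂ ∧ ∀ s t,
      f (leftTranslation Γ ℂ s * x * leftTranslation Γ ℂ t) = 0 ∧
      f (leftTranslation Γ ℂ s * star x * leftTranslation Γ ℂ t) = 0 := Iff.rfl

/-- Multiplying by a translation only changes the parameters `s, t`, and general multipliers follow
by closedness and linearity. Imposing the condition on `star x` as well makes the ideal self-adjoint
without assuming `f` hermitian. -/
theorem isProperClosedIdeal_functionalIdeal {f : (L2 Γ ℂ →L[ℂ] L2 Γ ℂ) →L[ℂ] ℂ} (hf : f 1 ≠ 0) :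
    IsProperClosedIdeal (functionalIdeal f) where
  isClosed := by
    have h : (functionalIdeal f : Set (L2 Γ ℂ →L[ℂ] L2 Γ ℂ))
        = (reducedGroupCStar Γ ℂ : Set (L2 Γ ℂ →L[ℂ] L2 Γ ℂ)) ∩ ⋂ s, ⋂ t,
          {x | f (leftTranslation Γ ℂ s * x * leftTranslation Γ ℂ t) = 0} ∩
          {x | f (leftTranslation Γ ℂ s * star x * leftTranslation Γ ℂ t) = 0} := by
      ext x
      simp only [SetLike.mem_coe, mem_functionalIdeal, Set.mem_iInter, Set.mem_inter_iff,
        Set.mem_ofPred_eq]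
    rw [h]
    refine isClosed_reducedGroupCStar.inter (isClosed_iInter fun s => isClosed_iInter fun t =>
      IsClosed.inter (isClosed_eq ?_ continuous_const) (isClosed_eq ?_ continuous_const))
    · exact f.continuous.comp ((continuous_const.mul continuous_id).mul continuous_const)
    · exact f.continuous.comp ((continuous_const.mul continuous_star).mul continuous_const)
  mem_reducedGroupCStar := fun h => h.1
  star_mem := by
    rintro x ⟨hx, hx'⟩
    refine ⟨star_mem hx, fun s t => ⟨(hx' s t).2, ?_⟩⟩
    rw [star_star]
    exact (hx' s t).1
  one_notMem := fun h => hf (by simpa using (h.2 1 1).1)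
  mul_mem_left := by
    rintro x y hx ⟨hy, hy'⟩
    refine ⟨mul_mem hx hy, fun s t => ?_⟩
    let V : Submodule ℂ (L2 Γ ℂ →L[ℂ] L2 Γ ℂ) :=
      { carrier := {x | f (leftTranslation Γ ℂ s * (x * y) * leftTranslation Γ ℂ t) = 0 ∧
          f (leftTranslation Γ ℂ s * star (x * y) * leftTranslation Γ ℂ t) = 0}
        zero_mem' := by simp
        add_mem' := by
          rintro a b ⟨ha, ha'⟩ ⟨hb, hb'⟩
          rw [star_mul] at ha' hb'
          constructor <;> simp [mul_add, add_mul, ha, hb, ha', hb']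
        smul_mem' := by
          rintro c a ⟨ha, ha'⟩
          rw [star_mul] at ha'
          constructor <;> simp [ha, ha'] }
    refine reducedGroupCStar_induction V (IsClosed.inter (isClosed_eq ?_ continuous_const)
      (isClosed_eq ?_ continuous_const)) (fun r => ⟨?_, ?_⟩) hx
    · exact f.continuous.comp ((continuous_const.mul
        (continuous_id.mul continuous_const)).mul continuous_const)
    · exact f.continuous.comp ((continuous_const.mul
        (continuous_star.comp (continuous_id.mul continuous_const))).mul continuous_const)
    · rw [← mul_assoc, ← map_mul (leftTranslation Γ ℂ)]
      exact (hy' _ _).1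
    · rw [star_mul, star_leftTranslation, mul_assoc, mul_assoc, ← map_mul (leftTranslation Γ ℂ),
        ← mul_assoc]
      exact (hy' _ _).2

/-- By normality, `s m t` and `s t` lie in the same coset of `N`, so the indicator of `N` does not
separate them. -/
theorem one_sub_leftTranslation_mem_functionalIdeal {f : (L2 Γ ℂ →L[ℂ] L2 Γ ℂ) →L[ℂ] ℂ}
    (N : Subgroup Γ) [N.Normal] (hf : ∀ s ∈ N, f (leftTranslation Γ ℂ s) = 1)
    (hf' : ∀ s ∉ N, f (leftTranslation Γ ℂ s) = 0) {n : Γ} (hn : n ∈ N) :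
    1 - leftTranslation Γ ℂ n ∈ functionalIdeal f := by
  have key : ∀ m ∈ N, ∀ s t, f (leftTranslation Γ ℂ s * (1 - leftTranslation Γ ℂ m)
      * leftTranslation Γ ℂ t) = 0 := by
    intro m hm s t
    have hiff : s * m * t ∈ N ↔ s * t ∈ N := by
      have h1 : s * m * t = (s * m * s⁻¹) * (s * t) := by group
      rw [h1]
      exact N.mul_mem_cancel_left (Subgroup.Normal.conj_mem inferInstance m hm s)
    rw [mul_sub, sub_mul, mul_one, ← map_mul, ← map_mul, ← map_mul, map_sub, sub_eq_zero]
    by_cases h : s * t ∈ N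
    · rw [hf _ h, hf _ (hiff.mpr h)]
    · rw [hf' _ h, hf' _ (fun h' => h (hiff.mp h'))]
  refine ⟨sub_mem (one_mem _) (leftTranslation_mem_reducedGroupCStar n), fun s t =>
    ⟨key n hn s t, ?_⟩⟩
  rw [star_sub, star_one, star_leftTranslation]
  exact key n⁻¹ (N.inv_mem hn) s t

end

section

variable {Γ : Type*} [Group Γ] {H : Type*} [NormedAddCommGroup H] [InnerProductSpace ℂ H]
  [CompleteSpace H] {A : Type*} [CStarAlgebra A] {α : Γ →* (A ≃⋆ₐ[ℂ] A)}
  {π : A →⋆ₐ[ℂ] (H →L[ℂ] H)} {φ : A →ₗ[ℂ] ℂ}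
  {E : reducedCrossedProduct α π ⊤ →L[ℂ] (L2 Γ ℂ →L[ℂ] L2 Γ ℂ)}

theorem exists_compress_eq_smul_one {x : L2 Γ H →L[ℂ] L2 Γ H} (hx : x ∈ reducedGroupCStar Γ H) :
    ∃ c : ℂ, compress x = c • (1 : H →L[ℂ] H) := by
  have h := reducedGroupCStar_induction
    ((ℂ ∙ (1 : H →L[ℂ] H)).comap (compress (Γ := Γ) (H := H)).toLinearMap)
    ((Submodule.closed_of_finiteDimensional (ℂ ∙ (1 : H →L[ℂ] H))).preimage
      compress.continuous) (fun s => ?_) hx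
  · obtain ⟨c, hc⟩ := Submodule.mem_span_singleton.mp h
    exact ⟨c, hc.symm⟩
  · by_cases hs : s = 1
    · subst hs
      refine Submodule.mem_span_singleton.mpr ⟨1, ?_⟩
      ext h
      simp
    · have : compress (leftTranslation Γ H s) = 0 := compress_leftTranslation hs
      change compress (leftTranslation Γ H s) ∈ (ℂ ∙ (1 : H →L[ℂ] H))
      rw [this]
      exact zero_mem _

theorem mem_bot_of_map_eq_smul_one (hπ : Function.Injective π) {a : A} {c : ℂ}
    (h : π a = c • (1 : H →L[ℂ] H)) : a ∈ (⊥ : StarSubalgebra ℂ A) := by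
  have : a = algebraMap ℂ A c := by
    apply hπ
    rw [h, AlgHomClass.commutes, Algebra.algebraMap_eq_smul_one]
  rw [this]
  exact algebraMap_mem _ c

/-- Covariance moves all translations to the right, so the compression can be read off from the
terms whose translation is trivial. -/
theorem one_sub_mul_regularRep_mul_one_sub (s t : Γ) (a : A) :
    (1 - leftTranslation Γ H s) * regularRep α π a * (1 - leftTranslation Γ H t)
      = regularRep α π a - regularRep α π (α s a) * leftTranslation Γ H s
        - regularRep α π a * leftTranslation Γ H t
        + regularRep α π (α s a) * leftTranslation Γ H (s * t) := by
  rw [map_mul, ← mul_assoc, ← leftTranslation_mul_regularRep]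
  noncomm_ring

theorem compress_one_sub_mul_regularRep_mul_one_sub {s t : Γ} (hs : s ≠ 1) (ht : t ≠ 1)
    (hst : s * t ≠ 1) (a : A) :
    compress ((1 - leftTranslation Γ H s) * regularRep α π a * (1 - leftTranslation Γ H t))
      = π a := by
  rw [one_sub_mul_regularRep_mul_one_sub, map_add, map_sub, map_sub, compress_regularRep,
    compress_regularRep_mul_leftTranslation α π hs, compress_regularRep_mul_leftTranslation α π ht,
    compress_regularRep_mul_leftTranslation α π hst]
  simp

theorem compress_one_sub_mul_regularRep_mul_one_sub_of_mul_eq_one {s t : Γ} (hs : s ≠ 1)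
    (ht : t ≠ 1) (hst : s * t = 1) (a : A) :
    compress ((1 - leftTranslation Γ H s) * regularRep α π a * (1 - leftTranslation Γ H t))
      = π (a + α s a) := by
  rw [one_sub_mul_regularRep_mul_one_sub, map_add, map_sub, map_sub, compress_regularRep,
    compress_regularRep_mul_leftTranslation α π hs, compress_regularRep_mul_leftTranslation α π ht,
    hst, map_one, mul_one, compress_regularRep]
  simp

/-- The intermediate algebra attached to a normal subgroup `N` whose trivial representation is
weakly contained in the regular one. -/
theorem exists_intermediate_of_normal (hφ : IsFaithfulInvariantState α φ)
    (hπ : Function.Injective π) (N : Subgroup Γ) [N.Normal]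
    {f : (L2 Γ ℂ →L[ℂ] L2 Γ ℂ) →L[ℂ] ℂ} (hf : ∀ s ∈ N, f (leftTranslation Γ ℂ s) = 1)
    (hf' : ∀ s ∉ N, f (leftTranslation Γ ℂ s) = 0) {s t : Γ} (hsN : s ∈ N) (htN : t ∈ N)
    (hs : s ≠ 1) (ht : t ≠ 1)
    (hA : (s * t ≠ 1 ∧ (⊥ : StarSubalgebra ℂ A) ≠ ⊤) ∨
      (s * t = 1 ∧ ¬ ∀ a, a + α s a ∈ (⊥ : StarSubalgebra ℂ A))) :
    ∃ D : StarSubalgebra ℂ (L2 Γ H →L[ℂ] L2 Γ H),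
      IsClosed (D : Set (L2 Γ H →L[ℂ] L2 Γ H)) ∧ reducedGroupCStar Γ H ≤ D ∧
      D ≤ reducedCrossedProduct α π ⊤ ∧ ¬ IsSubCrossedProduct α π D ∧
      D ⊓ (regularRep α π).range = ⊥ := by
  obtain ⟨E, hE⟩ := exists_isGroupExpectation α π hφ hπ
  have hJ : IsProperClosedIdeal (functionalIdeal f) := by
    refine isProperClosedIdeal_functionalIdeal ?_
    rw [← map_one (leftTranslation Γ ℂ), hf 1 N.one_mem]
    exact one_ne_zero
  refine exists_intermediate_of_ideal hφ hE hJ fun h => ?_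
  have hE1 : ∀ n ∈ N, E (1 - crossedTranslation α π n) ∈ functionalIdeal f := by
    intro n hn
    rw [map_sub, hE.map_one, hE.map_translation]
    exact one_sub_leftTranslation_mem_functionalIdeal N hf hf' hn
  have hmem : ∀ n, 1 - leftTranslation Γ H n ∈ reducedGroupCStar Γ H := fun n =>
    sub_mem (one_mem _) (leftTranslation_mem_reducedGroupCStar n)
  have h1 : ∀ a, (1 - leftTranslation Γ H s) * regularRep α π a * (1 - leftTranslation Γ H t)
      ∈ reducedGroupCStar Γ H :=
    h (1 - crossedTranslation α π s) (1 - crossedTranslation α π t) (hmem s) (hmem t)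
      (hE1 s hsN) (hE1 t htN)
  rcases hA with ⟨hst, hA⟩ | ⟨hst, hA⟩
  · refine hA (eq_top_iff.mpr fun a _ => ?_)
    obtain ⟨c, hc⟩ := exists_compress_eq_smul_one (h1 a)
    rw [compress_one_sub_mul_regularRep_mul_one_sub hs ht hst] at hc
    exact mem_bot_of_map_eq_smul_one hπ hc
  · refine hA fun a => ?_
    obtain ⟨c, hc⟩ := exists_compress_eq_smul_one (h1 a)
    rw [compress_one_sub_mul_regularRep_mul_one_sub_of_mul_eq_one hs ht hst] at hc
    exact mem_bot_of_map_eq_smul_one hπ hc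

end

/-- If `f + θ f` is constant for every `f`, then every continuous function is a root of a nonzero
quadratic polynomial, so the space has at most two points. -/
theorem ContinuousMap.not_forall_add_mem_bot {X : Type*} [TopologicalSpace X] [CompactSpace X]
    [T2Space X] (hX : 3 ≤ ENat.card X) (θ : C(X, ℂ) →⋆ₐ[ℂ] C(X, ℂ)) :
    ¬ ∀ f, f + θ f ∈ (⊥ : StarSubalgebra ℂ C(X, ℂ)) := by
  classical
  intro h
  obtain ⟨x, y, z, hxy, hxz, hyz⟩ : ∃ x y z : X, x ≠ y ∧ x ≠ z ∧ y ≠ z := by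
    have : Nonempty X := by
      by_contra hne
      rw [(ENat.card_eq_zero_iff_empty X).mpr (not_nonempty_iff.mp hne)] at hX
      exact absurd hX (by decide)
    let x : X := Classical.arbitrary X
    obtain ⟨y, hy, -⟩ := ENat.exists_ne_ne_of_three_le hX x x
    obtain ⟨z, hzx, hzy⟩ := ENat.exists_ne_ne_of_three_le hX x y
    exact ⟨x, y, z, hy.symm, hzx.symm, hzy.symm⟩
  obtain ⟨g, hg0, hg1, -⟩ := exists_continuous_zero_one_of_isClosed (s := {x}) (t := {y, z})
    isClosed_singleton (Set.toFinite _).isClosed (by simp [hxy, hxz])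
  obtain ⟨k, hk0, hk1, -⟩ := exists_continuous_zero_one_of_isClosed (s := {x, y}) (t := {z})
    (Set.toFinite _).isClosed isClosed_singleton (by simp [hyz.symm, hxz.symm])
  -- This `f` takes the values 0, 1, 2 at `x, y, z`, which is too many for roots of one quadratic.
  let f : C(X, ℂ) := ⟨fun w => ((g w + k w : ℝ) : ℂ), by fun_prop⟩
  obtain ⟨c, hc⟩ := Algebra.mem_bot.mp (h f)
  obtain ⟨d, hd⟩ := Algebra.mem_bot.mp (h (f * f))
  rw [map_mul] at hd
  -- Constancy of `f + θ f` gives `θ f = c - f`; multiplicativity turns constancy of `f² + θ(f²)`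
  -- into a quadratic equation for `f`.
  have hq : ∀ w, d = f w * f w + (c - f w) * (c - f w) := by
    intro w
    have hc' := congrArg (fun F : C(X, ℂ) => F w) hc
    have hd' := congrArg (fun F : C(X, ℂ) => F w) hd
    change c = f w + θ f w at hc'
    change d = f w * f w + θ f w * θ f w at hd'
    rw [hd', hc']
    ring
  have hfx : f x = 0 := by
    simp [f, hg0 (Set.mem_singleton x), hk0 (show x ∈ ({x, y} : Set X) by simp)]
  have hfy : f y = 1 := by
    simp [f, hg1 (show y ∈ ({y, z} : Set X) by simp), hk0 (show y ∈ ({x, y} : Set X) by simp)]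
  have hfz : f z = 2 := by
    simp [f, hg1 (show z ∈ ({y, z} : Set X) by simp), hk1 (Set.mem_singleton z)]
    norm_num
  have h0 := hq x
  have h1 := hq y
  have h2 := hq z
  rw [hfx] at h0
  rw [hfy] at h1
  rw [hfz] at h2
  have : (4 : ℂ) = 0 := by linear_combination 2 * h1 - h0 - h2
  norm_num at this

end

/-! ### Infinite conjugacy classes: density of ideals. -/

noncomputable section

open L2 Filter Topology

/-- The isometry of `ℓ²(Γ, H)` given by a permutation of the index set. -/
def L2.permute {Γ : Type*} (H : Type*) [NormedAddCommGroup H] [InnerProductSpace ℂ H]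
    (e : Γ ≃ Γ) : L2 Γ H →ₗᵢ[ℂ] L2 Γ H where
  toFun ξ := ⟨fun t => ξ (e t), memlp_two (e.summable_iff.mpr (summable_norm_sq ξ))⟩
  map_add' _ _ := rfl
  map_smul' _ _ := rfl
  norm_map' ξ := by
    refine (sq_eq_sq₀ (norm_nonneg _) (norm_nonneg _)).mp ?_
    rw [norm_sq_eq, norm_sq_eq]
    exact e.tsum_eq fun t => ‖ξ t‖ ^ 2

@[simp] theorem L2.permute_apply {Γ H : Type*} [NormedAddCommGroup H] [InnerProductSpace ℂ H]
    (e : Γ ≃ Γ) (ξ : L2 Γ H) (t : Γ) : permute H e ξ t = ξ (e t) := rfl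

section

variable {Γ : Type*} [Group Γ]

/-- The conjugation representation of `Γ` on `ℓ²(Γ)`. -/
def conjRep (g : Γ) : L2 Γ ℂ →ₗᵢ[ℂ] L2 Γ ℂ := permute ℂ (MulAut.conj g⁻¹).toEquiv

@[simp] theorem conjRep_apply (g : Γ) (ξ : L2 Γ ℂ) (t : Γ) :
    conjRep g ξ t = ξ (g⁻¹ * t * g) := by
  simp [conjRep]

theorem conjRep_delta (g s : Γ) (c : ℂ) : conjRep g (delta s c) = delta (g * s * g⁻¹) c := by
  classical
  ext t
  rw [conjRep_apply, delta_apply, delta_apply]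
  congr 1
  rw [eq_iff_iff]
  constructor
  · intro h
    rw [← h]
    group
  · intro h
    rw [h]
    group

theorem conjRep_apply_delta_one (g : Γ) {y : L2 Γ ℂ →L[ℂ] L2 Γ ℂ}
    (hy : y ∈ reducedGroupCStar Γ ℂ) :
    conjRep g (y (delta 1 1))
      = (leftTranslation Γ ℂ g * y * leftTranslation Γ ℂ g⁻¹) (delta 1 1) := by
  let V : Submodule ℂ (L2 Γ ℂ →L[ℂ] L2 Γ ℂ) :=
    { carrier := {y | conjRep g (y (delta 1 1))
        = (leftTranslation Γ ℂ g * y * leftTranslation Γ ℂ g⁻¹) (delta 1 1)}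
      zero_mem' := by simp
      add_mem' := fun {a b} (ha : _ = _) (hb : _ = _) => by
        change conjRep g ((a + b) (delta 1 1)) = _
        rw [add_apply, map_add, ha, hb, mul_add, add_mul,
          add_apply]
      smul_mem' := fun c a (ha : _ = _) => by
        change conjRep g ((c • a) (delta 1 1)) = _
        rw [smul_apply, map_smul, ha, mul_smul_comm, smul_mul_assoc,
          smul_apply] }
  let ev : (L2 Γ ℂ →L[ℂ] L2 Γ ℂ) →L[ℂ] L2 Γ ℂ := ContinuousLinearMap.apply ℂ _ (delta 1 1)
  refine reducedGroupCStar_induction V (isClosed_eq ?_ ?_) (fun s => ?_) hy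
  · exact (conjRep g).continuous.comp (ev.continuous)
  · have h : Continuous fun y => leftTranslation Γ ℂ g * y * leftTranslation Γ ℂ g⁻¹ :=
      (continuous_const.mul continuous_id).mul continuous_const
    exact ev.continuous.comp h
  · change conjRep g (leftTranslation Γ ℂ s (delta 1 1)) = _
    rw [← map_mul, ← map_mul, leftTranslation_delta, leftTranslation_delta, conjRep_delta, mul_one,
      mul_one]

/-- An invariant vector is constant on conjugacy classes, and a square summable function cannot be a
nonzero constant on an infinite set. -/
theorem L2.eq_smul_delta_one_of_conj_invariant (hicc : ∀ t : Γ, t ≠ 1 → (conjugatesOf t).Infinite)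
    {ζ : L2 Γ ℂ} (hζ : ∀ g, conjRep g ζ = ζ) : ζ = ζ 1 • delta 1 1 := by
  classical
  ext t
  by_cases ht : t = 1
  · subst ht
    simp
  have h0 : ζ t = 0 := by
    by_contra hne
    have hfin : ∀ᶠ s in cofinite, ‖ζ s‖ ^ 2 < ‖ζ t‖ ^ 2 :=
      (summable_norm_sq ζ).tendsto_cofinite_zero.eventually_lt_const (by positivity)
    refine hicc t ht (Set.Finite.subset (eventually_cofinite.mp hfin) ?_)
    intro s hs
    obtain ⟨g, rfl⟩ := isConj_iff.mp hs
    have : ζ (g * t * g⁻¹) = ζ t := by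
      have := conjRep_apply g ζ (g * t * g⁻¹)
      rw [hζ] at this
      rw [this]
      group
    simp [this]
  simp [h0, delta_apply_ne ht]

/-- In a group with infinite conjugacy classes, every nonzero ideal of `C⋆_r(Γ)` is strongly
dense. -/
theorem delta_one_mem_closure {J : Submodule ℂ (L2 Γ ℂ →L[ℂ] L2 Γ ℂ)}
    (hJ : IsProperClosedIdeal J) (hne : J ≠ ⊥)
    (hicc : ∀ t : Γ, t ≠ 1 → (conjugatesOf t).Infinite) :
    (delta 1 1 : L2 Γ ℂ) ∈ closure ((fun y : L2 Γ ℂ →L[ℂ] L2 Γ ℂ => y (delta 1 1)) '' J) := by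
  let ev : (L2 Γ ℂ →L[ℂ] L2 Γ ℂ) →L[ℂ] L2 Γ ℂ := ContinuousLinearMap.apply ℂ _ (delta 1 1)
  let W : Submodule ℂ (L2 Γ ℂ) := (J.map ev.toLinearMap).topologicalClosure
  have hWc : IsClosed (W : Set (L2 Γ ℂ)) := Submodule.isClosed_topologicalClosure _
  have : CompleteSpace W := hWc.completeSpace_coe
  have hmem : ∀ y ∈ J, y (delta 1 1) ∈ W := fun y hy =>
    Submodule.le_topologicalClosure _ ⟨y, hy, rfl⟩
  have hinv : ∀ g, ∀ w ∈ W, conjRep g w ∈ W := by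
    intro g w hw
    have h1 : (J.map ev.toLinearMap) ≤ W.comap (conjRep g).toLinearMap := by
      rintro _ ⟨y, hy, rfl⟩
      change conjRep g (y (delta 1 1)) ∈ W
      rw [conjRep_apply_delta_one g (hJ.mem_reducedGroupCStar hy)]
      exact hmem _ (hJ.mul_mem_right (hJ.mul_mem_left (leftTranslation_mem_reducedGroupCStar g) hy)
        (leftTranslation_mem_reducedGroupCStar g⁻¹))
    exact Submodule.topologicalClosure_minimal _ h1
      (hWc.preimage (conjRep g).continuous) hw
  -- Both `W` and `δ_1` are invariant under conjugation, hence so is the projection `ζ`, which is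
  -- therefore a multiple of `δ_1`.
  let ζ : L2 Γ ℂ := W.starProjection (delta 1 1)
  have hζW : ζ ∈ W := Submodule.starProjection_apply_mem _ _
  have hζ : ∀ g, conjRep g ζ = ζ := by
    intro g
    refine (Submodule.eq_starProjection_of_mem_of_inner_eq_zero (hinv g ζ hζW) fun w hw => ?_).symm
    have h1 : (delta 1 1 : L2 Γ ℂ) = conjRep g (delta 1 1) := by
      rw [conjRep_delta]
      simp
    have h2 : w = conjRep g (conjRep g⁻¹ w) := by
      ext t
      simp [mul_assoc]
    rw [h1, h2, ← map_sub, LinearIsometry.inner_map_map]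
    exact Submodule.starProjection_inner_eq_zero _ _ (hinv g⁻¹ w hw)
  have hζ1 := eq_smul_delta_one_of_conj_invariant hicc hζ
  -- If `ζ = 0`, then `δ_1` is orthogonal to `y⋆y δ_1` for each `y` in `J`, so `y δ_1 = 0`.
  -- Replacing `y` by `y λ_s` gives `y δ_s = 0`, hence `J = 0`.
  have hc : ζ 1 ≠ 0 := by
    intro h0
    rw [h0, zero_smul] at hζ1
    apply hne
    have key : ∀ y ∈ J, y (delta 1 1) = 0 := by
      intro y hy
      have h1 := Submodule.starProjection_inner_eq_zero (K := W) (delta 1 1) _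
        (hmem _ (hJ.mul_mem_left (star_mem (hJ.mem_reducedGroupCStar hy)) hy))
      change inner ℂ (delta 1 1 - ζ) ((star y * y) (delta 1 1)) = 0 at h1
      rw [hζ1, sub_zero, mul_apply_eq_comp, ContinuousLinearMap.star_eq_adjoint,
        ContinuousLinearMap.adjoint_inner_right] at h1
      exact inner_self_eq_zero.mp h1
    refine (Submodule.eq_bot_iff _).mpr fun y hy => clm_ext_complex fun s t => ?_
    have h2 := key _ (hJ.mul_mem_right hy (leftTranslation_mem_reducedGroupCStar s))
    rw [mul_apply_eq_comp, leftTranslation_delta, mul_one] at h2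
    rw [h2]
    rfl
  have hfin : (delta 1 1 : L2 Γ ℂ) ∈ W := by
    have : (delta 1 1 : L2 Γ ℂ) = (ζ 1)⁻¹ • ζ := by
      rw [hζ1]
      simp [smul_smul, hc]
    rw [this]
    exact W.smul_mem _ hζW
  exact hfin

end

section

variable {Γ : Type*} [Group Γ] {H : Type*} [NormedAddCommGroup H] [InnerProductSpace ℂ H]
  [CompleteSpace H] {A : Type*} [CStarAlgebra A] {α : Γ →* (A ≃⋆ₐ[ℂ] A)}
  {π : A →⋆ₐ[ℂ] (H →L[ℂ] H)} {φ : A →ₗ[ℂ] ℂ}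
  {E : reducedCrossedProduct α π ⊤ →L[ℂ] (L2 Γ ℂ →L[ℂ] L2 Γ ℂ)}

/-- On the copy of `C⋆_r(Γ)` acting on `ℓ²(Γ, H)`, `E` is a ⋆-homomorphism, injective by
faithfulness. Its range is thus closed, and it contains the translations. -/
theorem exists_lift_reducedGroupCStar (hE : IsGroupExpectation α π φ E)
    {y : L2 Γ ℂ →L[ℂ] L2 Γ ℂ} (hy : y ∈ reducedGroupCStar Γ ℂ) :
    ∃ x : reducedCrossedProduct α π ⊤,
      (x : L2 Γ H →L[ℂ] L2 Γ H) ∈ reducedGroupCStar Γ H ∧ E x = y := by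
  have hle := reducedGroupCStar_le_reducedCrossedProduct α π ⊤
  let F : reducedGroupCStar Γ H → (L2 Γ ℂ →L[ℂ] L2 Γ ℂ) := fun z => E ⟨z, hle z.2⟩
  have hone : F 1 = 1 := hE.map_one
  have hsmul : ∀ (c : ℂ) z, F (c • z) = c • F z := fun c z => E.map_smul c ⟨z, hle z.2⟩
  have hadd : ∀ z w, F (z + w) = F z + F w := fun z w => E.map_add ⟨z, hle z.2⟩ ⟨w, hle w.2⟩
  have hmul : ∀ z w, F (z * w) = F z * F w := fun z w =>
    hE.map_mul_of_mem_right ⟨z, hle z.2⟩ (y := ⟨w, hle w.2⟩) w.2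
  have hstar : ∀ z, F (star z) = star (F z) := fun z => hE.map_star ⟨z, hle z.2⟩
  have hfaith : ∀ z, F z = 0 → z = 0 := by
    intro z hz
    have h1 := hE.faithful ⟨z, hle z.2⟩ (by
      rw [hE.map_mul_of_mem_right _ z.2]
      change _ * F z = 0
      rw [hz, mul_zero])
    have h2 : (z : L2 Γ H →L[ℂ] L2 Γ H) = 0 := congrArg Subtype.val h1
    exact Subtype.ext h2
  have htrans : ∀ s, F ⟨leftTranslation Γ H s, leftTranslation_mem_reducedGroupCStar s⟩
      = leftTranslation Γ ℂ s := hE.map_translation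
  suffices h : ∃ z, F z = y by
    obtain ⟨z, hz⟩ := h
    exact ⟨⟨z, hle z.2⟩, z.2, hz⟩
  clear_value F
  let Φ : reducedGroupCStar Γ H →⋆ₐ[ℂ] (L2 Γ ℂ →L[ℂ] L2 Γ ℂ) :=
    { toFun := F
      map_one' := hone
      map_mul' := hmul
      map_zero' := by simpa using hsmul 0 0
      map_add' := hadd
      commutes' := fun c => by
        rw [Algebra.algebraMap_eq_smul_one, hsmul, hone, Algebra.algebraMap_eq_smul_one]
      map_star' := hstar }
  have hinj : Function.Injective Φ := (injective_iff_map_eq_zero Φ).mpr hfaith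
  have hclosed : IsClosed (Φ.range : Set (L2 Γ ℂ →L[ℂ] L2 Γ ℂ)) := by
    have : IsClosed (reducedGroupCStar Γ H : Set (L2 Γ H →L[ℂ] L2 Γ H)) :=
      isClosed_reducedGroupCStar
    exact (NonUnitalStarAlgHom.isometry Φ hinj).isClosedEmbedding.isClosed_range
  exact reducedGroupCStar_le hclosed (fun s => ⟨_, htrans s⟩) hy

/-- Both sides are the canonical trace of `z`, as one checks on translations. -/
theorem IsGroupExpectation.compress_eq (hE : IsGroupExpectation α π φ E)
    {z : reducedCrossedProduct α π ⊤}
    (hz : (z : L2 Γ H →L[ℂ] L2 Γ H) ∈ reducedGroupCStar Γ H) :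
    compress (z : L2 Γ H →L[ℂ] L2 Γ H) = (E z (delta 1 1) 1) • (1 : H →L[ℂ] H) := by
  let τ : reducedCrossedProduct α π ⊤ →L[ℂ] ℂ :=
    coord 1 ∘L ContinuousLinearMap.apply ℂ _ (delta 1 1) ∘L E
  let F : reducedCrossedProduct α π ⊤ →L[ℂ] (H →L[ℂ] H) :=
    compress ∘L (reducedCrossedProduct α π ⊤).toSubalgebra.toSubmodule.subtypeL
  let G : reducedCrossedProduct α π ⊤ →L[ℂ] (H →L[ℂ] H) := τ.smulRight 1
  have h := crossedProduct_induction_group α π (V := (F - G).ker) (F - G).isClosed_ker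
    (fun s => ?_) hz
  · have h' : F z - G z = 0 := h
    exact sub_eq_zero.mp h'
  · change F (crossedTranslation α π s) - G (crossedTranslation α π s) = 0
    rw [sub_eq_zero]
    change compress (leftTranslation Γ H s)
      = (E (crossedTranslation α π s) (delta 1 1) 1) • (1 : H →L[ℂ] H)
    rw [hE.map_translation, leftTranslation_delta, mul_one]
    by_cases hs : s = 1
    · subst hs
      ext h
      simp
    · rw [compress_leftTranslation hs, delta_apply_ne (Ne.symm hs), zero_smul]

end
end

/-! ### The intermediate algebra for infinite conjugacy classes. -/

noncomputable section

open L2 Filter Topology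

/-- The closed selfadjoint ideal of operators attached to a closed ideal of `C⋆_r(Γ)`. -/
def TwoSidedIdeal.selfadjointPart {Γ : Type*} [Group Γ]
    (I : TwoSidedIdeal (reducedGroupCStar Γ ℂ)) :
    Submodule ℂ (L2 Γ ℂ →L[ℂ] L2 Γ ℂ) where
  carrier := {x | ∃ z : reducedGroupCStar Γ ℂ, z ∈ I ∧ star z ∈ I ∧
    (z : L2 Γ ℂ →L[ℂ] L2 Γ ℂ) = x}
  zero_mem' := ⟨0, I.zero_mem, by rw [star_zero]; exact I.zero_mem, rfl⟩
  add_mem' := by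
    rintro _ _ ⟨z, hz, hz', rfl⟩ ⟨w, hw, hw', rfl⟩
    exact ⟨z + w, I.add_mem hz hw, by rw [star_add]; exact I.add_mem hz' hw', rfl⟩
  smul_mem' := by
    rintro c _ ⟨z, hz, hz', rfl⟩
    refine ⟨c • z, ?_, ?_, rfl⟩
    · rw [← one_mul z, ← smul_mul_assoc]
      exact I.mul_mem_left _ _ hz
    · rw [star_smul, ← one_mul (star z), ← smul_mul_assoc]
      exact I.mul_mem_left _ _ hz'

theorem isProperClosedIdeal_selfadjointPart {Γ : Type*} [Group Γ]
    {I : TwoSidedIdeal (reducedGroupCStar Γ ℂ)}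
    (hI : IsClosed (I : Set (reducedGroupCStar Γ ℂ))) (htop : I ≠ ⊤) :
    IsProperClosedIdeal I.selfadjointPart where
  isClosed := by
    have h1 : IsClosed {z : reducedGroupCStar Γ ℂ | z ∈ I ∧ star z ∈ I} :=
      IsClosed.inter hI (hI.preimage continuous_star)
    have h2 := (isClosed_reducedGroupCStar (Γ := Γ)
      (H := ℂ)).isClosedEmbedding_subtypeVal.isClosedMap _ h1
    convert h2 using 1
    ext x
    constructor
    · rintro ⟨z, hz, hz', rfl⟩
      exact ⟨z, ⟨hz, hz'⟩, rfl⟩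
    · rintro ⟨z, ⟨hz, hz'⟩, rfl⟩
      exact ⟨z, hz, hz', rfl⟩
  mem_reducedGroupCStar := by
    rintro _ ⟨z, -, -, rfl⟩
    exact z.2
  mul_mem_left := by
    rintro x _ hx ⟨z, hz, hz', rfl⟩
    refine ⟨⟨x, hx⟩ * z, I.mul_mem_left _ _ hz, ?_, rfl⟩
    rw [star_mul]
    exact I.mul_mem_right _ _ hz'
  star_mem := by
    rintro _ ⟨z, hz, hz', rfl⟩
    exact ⟨star z, hz', by rwa [star_star], rfl⟩
  one_notMem := by
    rintro ⟨z, hz, -, hz1⟩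
    have : z = 1 := Subtype.ext hz1
    subst this
    exact htop ((TwoSidedIdeal.one_mem_iff I).mp hz)

/-- For a nonzero `z` in `I`, the self-adjoint element `star z * z` is nonzero and lies in `I`. -/
theorem selfadjointPart_ne_bot {Γ : Type*} [Group Γ] {I : TwoSidedIdeal (reducedGroupCStar Γ ℂ)}
    (hbot : I ≠ ⊥) : I.selfadjointPart ≠ ⊥ := by
  intro h
  apply hbot
  refine le_bot_iff.mp fun z hz => ?_
  have hs : star (star z * z) = star z * z := by rw [star_mul, star_star]
  have hz' : star z * z ∈ I := I.mul_mem_left _ _ hz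
  have h1 : ((star z * z : reducedGroupCStar Γ ℂ) : L2 Γ ℂ →L[ℂ] L2 Γ ℂ) ∈ I.selfadjointPart :=
    ⟨star z * z, hz', by rw [hs]; exact hz', rfl⟩
  rw [h, Submodule.mem_bot] at h1
  have h2 : (z : L2 Γ ℂ →L[ℂ] L2 Γ ℂ) = 0 := CStarRing.star_mul_self_eq_zero_iff _ |>.mp h1
  rw [TwoSidedIdeal.mem_bot]
  exact Subtype.ext h2

variable {Γ : Type*} [Group Γ] {H : Type*} [NormedAddCommGroup H] [InnerProductSpace ℂ H]
  [CompleteSpace H] {A : Type*} [CStarAlgebra A] {α : Γ →* (A ≃⋆ₐ[ℂ] A)}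
  {π : A →⋆ₐ[ℂ] (H →L[ℂ] H)} {φ : A →ₗ[ℂ] ℂ}
  {E : reducedCrossedProduct α π ⊤ →L[ℂ] (L2 Γ ℂ →L[ℂ] L2 Γ ℂ)}

theorem L2.inner_apply_delta (x T : L2 Γ H →L[ℂ] L2 Γ H) (h : H) :
    inner ℂ (x (delta 1 h)) (T (x (delta 1 h))) = inner ℂ h (compress (star x * T * x) h) := by
  rw [compress_apply, ← inner_delta_left, mul_apply_eq_comp, mul_apply_eq_comp,
    ContinuousLinearMap.star_eq_adjoint, ContinuousLinearMap.adjoint_inner_right]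

theorem L2.inner_apply_delta_self (x : L2 Γ H →L[ℂ] L2 Γ H) (h : H) :
    inner ℂ (x (delta 1 h)) (x (delta 1 h)) = inner ℂ h (compress (star x * x) h) := by
  simpa using inner_apply_delta x 1 h

theorem star_mul_self_apply_delta_one (y : L2 Γ ℂ →L[ℂ] L2 Γ ℂ) :
    (star y * y) (delta 1 1) 1 = ((‖y (delta 1 1)‖ ^ 2 : ℝ) : ℂ) := by
  have h := inner_apply_delta_self (H := ℂ) y 1
  rw [inner_self_eq_norm_sq_to_K] at h
  simpa using h.symm

/-- Both norms are computed by the trace of `z⋆z`. This transfers convergence at `δ_1` from `ℓ²(Γ)`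
to `ℓ²(Γ, H)`. -/
theorem norm_apply_delta_eq (hE : IsGroupExpectation α π φ E) {z : reducedCrossedProduct α π ⊤}
    (hz : (z : L2 Γ H →L[ℂ] L2 Γ H) ∈ reducedGroupCStar Γ H) (h : H) :
    ‖(z : L2 Γ H →L[ℂ] L2 Γ H) (delta 1 h)‖ = ‖E z (delta 1 1)‖ * ‖h‖ := by
  have h1 := inner_apply_delta_self (z : L2 Γ H →L[ℂ] L2 Γ H) h
  have h2 := hE.compress_eq (z := star z * z) (mul_mem (star_mem hz) hz)
  change compress (star (z : L2 Γ H →L[ℂ] L2 Γ H) * (z : L2 Γ H →L[ℂ] L2 Γ H)) = _ at h2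
  rw [hE.map_mul_of_mem_right _ hz, hE.map_star, star_mul_self_apply_delta_one] at h2
  rw [h2, inner_self_eq_norm_sq_to_K, smul_apply, inner_smul_right, one_apply_eq_self,
    inner_self_eq_norm_sq_to_K] at h1
  have h3 : ‖(z : L2 Γ H →L[ℂ] L2 Γ H) (delta 1 h)‖ ^ 2 = (‖E z (delta 1 1)‖ * ‖h‖) ^ 2 := by
    rw [mul_pow]
    apply Complex.ofReal_injective
    push_cast at h1 ⊢
    exact h1
  exact (sq_eq_sq₀ (norm_nonneg _) (by positivity)).mp h3

/-- The intermediate algebra for a group with infinite conjugacy classes that is not C⋆-simple. -/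
theorem exists_intermediate_of_icc (hΓ : ¬ IsCStarSimple Γ)
    (hicc : ∀ t : Γ, t ≠ 1 → (conjugatesOf t).Infinite) (hφ : IsFaithfulInvariantState α φ)
    (hπ : Function.Injective π) (hA : (⊥ : StarSubalgebra ℂ A) ≠ ⊤) :
    ∃ D : StarSubalgebra ℂ (L2 Γ H →L[ℂ] L2 Γ H),
      IsClosed (D : Set (L2 Γ H →L[ℂ] L2 Γ H)) ∧ reducedGroupCStar Γ H ≤ D ∧
      D ≤ reducedCrossedProduct α π ⊤ ∧ ¬ IsSubCrossedProduct α π D ∧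
      D ⊓ (regularRep α π).range = ⊥ := by
  obtain ⟨I, hIc, hI⟩ : ∃ I : TwoSidedIdeal (reducedGroupCStar Γ ℂ),
      IsClosed (I : Set (reducedGroupCStar Γ ℂ)) ∧ ¬ (I = ⊥ ∨ I = ⊤) := by
    by_contra hne
    exact hΓ fun I hI => by_contra fun h => hne ⟨I, hI, h⟩
  obtain ⟨hbot, htop⟩ := not_or.mp hI
  have hJ := isProperClosedIdeal_selfadjointPart hIc htop
  have hJne := selfadjointPart_ne_bot hbot
  set J := I.selfadjointPart
  obtain ⟨E, hE⟩ := exists_isGroupExpectation α π hφ hπ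
  refine exists_intermediate_of_ideal hφ hE hJ fun hD => hA (eq_top_iff.mpr fun a _ => ?_)
  obtain ⟨u, hu, hlim⟩ := mem_closure_iff_seq_limit.mp (delta_one_mem_closure hJ hJne hicc)
  choose y hyJ hyu using hu
  choose x hx hxy using fun n => exists_lift_reducedGroupCStar hE (hJ.mem_reducedGroupCStar (hyJ n))
  have hlim1 : Tendsto (fun n => y n (delta 1 1)) atTop (𝓝 (delta 1 1 : L2 Γ ℂ)) := by
    simpa only [hyu] using hlim
  have hlim2 : ∀ h : H, Tendsto (fun n => (x n : L2 Γ H →L[ℂ] L2 Γ H) (delta 1 h)) atTop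
      (𝓝 (delta 1 h)) := by
    intro h
    rw [tendsto_iff_norm_sub_tendsto_zero] at hlim1 ⊢
    have h1 : ∀ n, ‖(x n : L2 Γ H →L[ℂ] L2 Γ H) (delta 1 h) - delta 1 h‖
        = ‖y n (delta 1 1) - delta 1 1‖ * ‖h‖ := by
      intro n
      have h2 := norm_apply_delta_eq hE (z := x n - 1) (sub_mem (hx n) (one_mem _)) h
      rw [map_sub, hE.map_one, hxy] at h2
      exact h2
    simp only [h1]
    simpa using hlim1.mul_const ‖h‖
  -- By `hD` the operator lies in `C⋆_r(Γ)`, so its compression is the trace of its image `φ(a) y_n⋆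
  -- y_n` under `E`.
  have hcomp : ∀ n, compress (star (x n : L2 Γ H →L[ℂ] L2 Γ H) * regularRep α π a *
      (x n : L2 Γ H →L[ℂ] L2 Γ H))
      = (φ a * ((‖y n (delta 1 1)‖ ^ 2 : ℝ) : ℂ)) • (1 : H →L[ℂ] H) := by
    intro n
    have h1 := hD (star (x n)) (x n) (star_mem (hx n)) (hx n)
      (by rw [hE.map_star, hxy]; exact hJ.star_mem (hyJ n)) (by rw [hxy]; exact hyJ n) a
    have h2 := hE.compress_eq (z := star (x n) * crossedRep α π a * x n) h1
    rw [hE.map_mul_of_mem_right _ (hx n), hE.map_mul_of_mem_left (star_mem (hx n)), hE.map_star,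
      hE.map_rep, hxy, mul_smul_comm, mul_one, smul_mul_assoc, smul_apply, lp.coeFn_smul,
      Pi.smul_apply, star_mul_self_apply_delta_one, smul_eq_mul] at h2
    exact h2
  refine mem_bot_of_map_eq_smul_one hπ (c := φ a) ?_
  rw [← sub_eq_zero]
  have hinner : ∀ h : H, inner ℂ h (π a h) = φ a * inner ℂ h h := by
    intro h
    have h1 : Tendsto (fun n => inner ℂ ((x n : L2 Γ H →L[ℂ] L2 Γ H) (delta 1 h))
        (regularRep α π a ((x n : L2 Γ H →L[ℂ] L2 Γ H) (delta 1 h)))) atTop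
        (𝓝 (inner ℂ (delta 1 h : L2 Γ H) (regularRep α π a (delta 1 h)))) :=
      (hlim2 h).inner (((regularRep α π a).continuous.tendsto _).comp (hlim2 h))
    have h2 : Tendsto (fun n => φ a * ((‖y n (delta 1 1)‖ ^ 2 : ℝ) : ℂ) * inner ℂ h h) atTop
        (𝓝 (φ a * ((‖(delta 1 1 : L2 Γ ℂ)‖ ^ 2 : ℝ) : ℂ) * inner ℂ h h)) :=
      (((Complex.continuous_ofReal.tendsto _).comp (hlim1.norm.pow 2)).const_mul _).mul_const _
    have h3 := tendsto_nhds_unique (h1.congr fun n => by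
      rw [inner_apply_delta, hcomp, smul_apply, one_apply_eq_self, inner_smul_right]) h2
    simpa using h3
  -- Over `ℂ`, an operator with vanishing quadratic form is zero.
  have hzero : ((π a - φ a • 1 : H →L[ℂ] H) : H →ₗ[ℂ] H) = 0 := by
    refine (inner_map_self_eq_zero _).mp fun h => ?_
    rw [← inner_conj_symm]
    have : inner ℂ h ((π a - φ a • 1 : H →L[ℂ] H) h) = 0 := by
      rw [sub_apply, inner_sub_right, hinner, smul_apply, one_apply_eq_self, inner_smul_right,
        sub_self]
    exact (congrArg _ this).trans (map_zero _)
  exact ContinuousLinearMap.coe_injective hzero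

end

/-! ### Functionals for finite and abelian subgroups, and the structure of FC normal closures. -/

noncomputable section

open L2

section

variable {Γ : Type*} [Group Γ]

theorem exists_functional_of_finite (N : Subgroup Γ) (hN : (N : Set Γ).Finite) :
    ∃ f : (L2 Γ ℂ →L[ℂ] L2 Γ ℂ) →L[ℂ] ℂ, (∀ s ∈ N, f (leftTranslation Γ ℂ s) = 1) ∧
      ∀ s ∉ N, f (leftTranslation Γ ℂ s) = 0 := by
  classical
  let f : (L2 Γ ℂ →L[ℂ] L2 Γ ℂ) →L[ℂ] ℂ :=
    -- Summing the coefficients of `x δ_1` over `N` is bounded because `N` is finite.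
    ∑ g ∈ hN.toFinset, coord g ∘L ContinuousLinearMap.apply ℂ (L2 Γ ℂ) (delta 1 1)
  have hf : ∀ s, f (leftTranslation Γ ℂ s) = if s ∈ N then 1 else 0 := by
    intro s
    simp [f, delta_apply]
  exact ⟨f, fun s hs => by rw [hf, if_pos hs], fun s hs => by rw [hf, if_neg hs]⟩

theorem CommCStarAlgebra.exists_starAlgHom (B : Type*) [CommCStarAlgebra B] [Nontrivial B] :
    Nonempty (B →⋆ₐ[ℂ] ℂ) := by
  obtain ⟨χ⟩ : Nonempty (WeakDual.characterSpace ℂ B) := inferInstance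
  exact ⟨{ WeakDual.CharacterSpace.toAlgHom χ with map_star' := fun x => map_star χ x }⟩

theorem reducedGroupCStar_commute {N : Type*} [Group N] (hN : ∀ a b : N, a * b = b * a)
    {x y : L2 N ℂ →L[ℂ] L2 N ℂ} (hx : x ∈ reducedGroupCStar N ℂ)
    (hy : y ∈ reducedGroupCStar N ℂ) : x * y = y * x := by
  have key : ∀ z, (∀ s, leftTranslation N ℂ s * z = z * leftTranslation N ℂ s) →
      ∀ w ∈ reducedGroupCStar N ℂ, w * z = z * w := by
    intro z hz w hw
    let V : Submodule ℂ (L2 N ℂ →L[ℂ] L2 N ℂ) :=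
      { carrier := {w | w * z = z * w}
        zero_mem' := by simp
        add_mem' := fun {a b} (ha : _ = _) (hb : _ = _) => by
          change (a + b) * z = z * (a + b)
          rw [add_mul, mul_add, ha, hb]
        smul_mem' := fun c a (ha : _ = _) => by
          change (c • a) * z = z * (c • a)
          rw [smul_mul_assoc, mul_smul_comm, ha] }
    exact reducedGroupCStar_induction V
      (isClosed_eq (continuous_id.mul continuous_const) (continuous_const.mul continuous_id)) hz hw
  refine key y (fun s => ?_) x hx
  refine (key _ (fun t => ?_) y hy).symm
  rw [← map_mul, ← map_mul, hN]

theorem exists_starAlgHom_reducedGroupCStar {N : Type*} [Group N] (hN : ∀ a b : N, a * b = b * a) :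
    Nonempty (reducedGroupCStar N ℂ →⋆ₐ[ℂ] ℂ) := by
  have : IsClosed (reducedGroupCStar N ℂ : Set (L2 N ℂ →L[ℂ] L2 N ℂ)) := isClosed_reducedGroupCStar
  let _ : CommCStarAlgebra (reducedGroupCStar N ℂ) :=
    { (inferInstance : CStarAlgebra (reducedGroupCStar N ℂ)) with
      mul_comm := fun x y => Subtype.ext (reducedGroupCStar_commute hN x.2 y.2) }
  have : Nontrivial (L2 N ℂ) := ⟨delta 1 1, 0, fun h => by
    have := congrArg norm h
    simp at this⟩
  have : Nontrivial (reducedGroupCStar N ℂ) := ⟨1, 0, fun h =>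
    one_ne_zero (α := L2 N ℂ →L[ℂ] L2 N ℂ) (congrArg Subtype.val h)⟩
  exact CommCStarAlgebra.exists_starAlgHom _

/-- The compression of the regular representation of `Γ` to a subgroup `N`, twisted by a unitary
character of `N`. -/
theorem exists_twisted_compression (N : Subgroup Γ) (χ : N →* ℂ) (hχ : ∀ s, ‖χ s‖ = 1) :
    ∃ T : (L2 Γ ℂ →L[ℂ] L2 Γ ℂ) →L[ℂ] (L2 N ℂ →L[ℂ] L2 N ℂ),
      (∀ s : N, T (leftTranslation Γ ℂ s) = star (χ s) • leftTranslation N ℂ s) ∧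
      ∀ s ∉ N, T (leftTranslation Γ ℂ s) = 0 := by
  classical
  have hv : Orthonormal ℂ fun s : N => (delta (s : Γ) (χ s) : L2 Γ ℂ) := by
    refine ⟨fun s => by rw [norm_delta, hχ], fun s t hst => ?_⟩
    change inner ℂ (delta (s : Γ) (χ s) : L2 Γ ℂ) (delta (t : Γ) (χ t)) = 0
    rw [inner_delta_left, delta_apply_ne fun h => hst (Subtype.ext h), inner_zero_right]
  obtain ⟨V₀, hV₀⟩ := hv.exists_linearIsometry
  let V : L2 N ℂ →L[ℂ] L2 Γ ℂ := V₀.toContinuousLinearMap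
  -- Sending `δ_s` to `χ(s) δ_s` makes the compression multiply `λ_s` by the conjugate of `χ(s)`.
  have hV : ∀ s : N, V (delta s 1) = delta (s : Γ) (χ s) := hV₀
  let T : (L2 Γ ℂ →L[ℂ] L2 Γ ℂ) →L[ℂ] (L2 N ℂ →L[ℂ] L2 N ℂ) :=
    { toFun := fun x => ContinuousLinearMap.adjoint V ∘L x ∘L V
      map_add' := fun x y => by ext; simp
      map_smul' := fun c x => by ext; simp
      cont := by fun_prop }
  have hT : ∀ (g : Γ) (s t : N), T (leftTranslation Γ ℂ g) (delta s 1) t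
      = star (χ t) * if (t : Γ) = g * s then χ s else 0 := by
    intro g s t
    have h1 : T (leftTranslation Γ ℂ g) (delta s 1) t
        = inner ℂ (delta t (1 : ℂ)) (T (leftTranslation Γ ℂ g) (delta s 1)) := by
      simp
    rw [h1]
    change inner ℂ (delta t (1 : ℂ))
      (ContinuousLinearMap.adjoint V (leftTranslation Γ ℂ g (V (delta s 1)))) = _
    rw [ContinuousLinearMap.adjoint_inner_right, hV, hV, leftTranslation_delta, inner_delta_left,
      delta_apply]
    simp [mul_comm]
  refine ⟨T, fun g => clm_ext_complex fun s t => ?_, fun g hg => clm_ext_complex fun s t => ?_⟩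
  · rw [hT, smul_apply, leftTranslation_delta, lp.coeFn_smul, Pi.smul_apply, delta_apply]
    by_cases h : t = g * s
    · subst h
      have h2 : star (χ s) * χ s = 1 := by
        rw [Complex.star_def, Complex.conj_mul', hχ]
        simp
      rw [if_pos (by simp), if_pos rfl, map_mul, star_mul, mul_right_comm, h2, one_mul,
        smul_eq_mul, mul_one]
    · rw [if_neg (fun h' => h (Subtype.ext (by simpa using h'))), if_neg h]
      simp
  · rw [hT, if_neg]
    · simp
    · intro h
      apply hg
      have : g = t * (s : Γ)⁻¹ := by rw [h]; group
      rw [this]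
      exact N.mul_mem t.2 (N.inv_mem s.2)

/-- The commutative algebra `C⋆_r(N)` has some character `χ₀`, with unitary restriction `χ` to `N`.
Twisting by the conjugate of `χ` before applying a Hahn–Banach extension of `χ₀` turns `χ` into the
trivial character, with no appeal to amenability. -/
theorem exists_functional_of_commutative (N : Subgroup Γ) (hN : ∀ a b : N, a * b = b * a) :
    ∃ f : (L2 Γ ℂ →L[ℂ] L2 Γ ℂ) →L[ℂ] ℂ, (∀ s ∈ N, f (leftTranslation Γ ℂ s) = 1) ∧
      ∀ s ∉ N, f (leftTranslation Γ ℂ s) = 0 := by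
  obtain ⟨χ₀⟩ := exists_starAlgHom_reducedGroupCStar hN
  have hcont : ∀ x : reducedGroupCStar N ℂ, ‖χ₀ x‖ ≤ 1 * ‖x‖ := by
    have : IsClosed (reducedGroupCStar N ℂ : Set (L2 N ℂ →L[ℂ] L2 N ℂ)) :=
      isClosed_reducedGroupCStar
    intro x
    rw [one_mul]
    exact NonUnitalStarAlgHom.norm_apply_le χ₀ x
  let U : N →* reducedGroupCStar N ℂ := (leftTranslation N ℂ).codRestrict (reducedGroupCStar N ℂ)
    leftTranslation_mem_reducedGroupCStar
  let χ : N →* ℂ := (χ₀ : reducedGroupCStar N ℂ →* ℂ).comp U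
  have hχ : ∀ s, star (χ s) * χ s = 1 := by
    intro s
    have h1 : star (U s) = U s⁻¹ := Subtype.ext (star_leftTranslation s)
    have h2 : star (χ s) = χ s⁻¹ := by
      change star (χ₀ (U s)) = χ₀ (U s⁻¹)
      rw [← map_star, h1]
    rw [h2, ← map_mul, inv_mul_cancel, map_one]
  have hnorm : ∀ s, ‖χ s‖ = 1 := by
    intro s
    have h1 := congrArg norm (hχ s)
    rw [norm_mul, norm_star, norm_one] at h1
    nlinarith [norm_nonneg (χ s)]
  obtain ⟨T, hT, hT'⟩ := exists_twisted_compression N χ hnorm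
  let W : Submodule ℂ (L2 N ℂ →L[ℂ] L2 N ℂ) :=
    Subalgebra.toSubmodule (reducedGroupCStar N ℂ).toSubalgebra
  let f₀ : StrongDual ℂ W := LinearMap.mkContinuous
    { toFun := fun x => χ₀ ⟨x.1, x.2⟩
      map_add' := fun x y => map_add χ₀ ⟨x.1, x.2⟩ ⟨y.1, y.2⟩
      map_smul' := fun c x => map_smul χ₀ c ⟨x.1, x.2⟩ } 1 fun x => hcont ⟨x.1, x.2⟩
  obtain ⟨F, hF, -⟩ := exists_extension_norm_eq W f₀
  refine ⟨F ∘L T, fun s hs => ?_, fun s hs => ?_⟩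
  · have h1 : F (leftTranslation N ℂ ⟨s, hs⟩) = χ ⟨s, hs⟩ :=
      hF ⟨leftTranslation N ℂ ⟨s, hs⟩, leftTranslation_mem_reducedGroupCStar _⟩
    rw [ContinuousLinearMap.comp_apply, hT ⟨s, hs⟩, map_smul, h1, smul_eq_mul, hχ]
  · rw [ContinuousLinearMap.comp_apply, hT' s hs, map_zero]

/-- The normal closure of a finite set of elements with finite conjugacy classes is finite or has
infinite center. -/
theorem finite_normalClosure_of_finite_center {S : Set Γ} (hS : (Group.conjugatesOfSet S).Finite)
    (hZ : ((Subgroup.normalClosure S ⊓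
      Subgroup.centralizer (Subgroup.normalClosure S : Set Γ) : Subgroup Γ) : Set Γ).Finite) :
    (Subgroup.normalClosure S : Set Γ).Finite := by
  set C := Group.conjugatesOfSet S with hC
  set N := Subgroup.normalClosure S with hN
  have : Finite C := hS
  -- Restricted to `N`, this records conjugation on the finite set `C`, so it has finitely many
  -- values. Since `C` generates `N`, its fibres in `N` lie in cosets of the center of `N`.
  let F : Γ → (C → Γ) := fun n s => n * s * n⁻¹
  refine Set.Finite.of_finite_fibers (f := F) ?_ ?_
  · refine Set.Finite.subset (Set.Finite.pi' (t := fun _ : C => C) fun _ => hS) ?_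
    rintro _ ⟨n, -, rfl⟩ s
    exact Group.conj_mem_conjugatesOfSet s.2
  · rintro _ ⟨n, hn, rfl⟩
    refine (hZ.image fun z => n * z).subset ?_
    rintro m ⟨hm, hmn⟩
    have hmn' : F m = F n := hmn
    refine ⟨n⁻¹ * m, ⟨N.mul_mem (N.inv_mem hn) hm, ?_⟩, by simp⟩
    have h1 : C ⊆ Subgroup.centralizer {n⁻¹ * m} := by
      intro s hs
      rw [SetLike.mem_coe, Subgroup.mem_centralizer_singleton_iff]
      have h2 : m * s * m⁻¹ = n * s * n⁻¹ := congrFun hmn' ⟨s, hs⟩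
      have h3 : m * s = n * s * n⁻¹ * m := by rw [← h2]; group
      calc s * (n⁻¹ * m) = n⁻¹ * (n * s * n⁻¹ * m) := by group
        _ = n⁻¹ * m * s := by rw [← h3]; group
    have h4 : N ≤ Subgroup.centralizer {n⁻¹ * m} := (Subgroup.closure_le _).mpr h1
    refine Subgroup.mem_centralizer_iff.mpr ?_
    intro s hs
    exact Subgroup.mem_centralizer_singleton_iff.mp (h4 hs)

end

end

/-! ### Case analysis on the FC-center, and the two assertions. -/

noncomputable section

open L2

section

variable {Γ : Type*} [Group Γ]

instance fcCenter_normal : (fcCenter Γ).Normal where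
  conj_mem n hn g := by
    have h : conjugatesOf (g * n * g⁻¹) = conjugatesOf n :=
      (isConj_iff_conjugatesOf_eq.mp (isConj_iff.mpr ⟨g, rfl⟩)).symm
    change (conjugatesOf (g * n * g⁻¹)).Finite
    rw [h]
    exact hn

theorem exists_intermediate {A : Type*} [CStarAlgebra A] {α : Γ →* (A ≃⋆ₐ[ℂ] A)}
    {H : Type*} [NormedAddCommGroup H] [InnerProductSpace ℂ H] [CompleteSpace H]
    {π : A →⋆ₐ[ℂ] (H →L[ℂ] H)} {φ : A →ₗ[ℂ] ℂ} (hΓ : ¬ IsCStarSimple Γ)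
    (hA : (⊥ : StarSubalgebra ℂ A) ≠ ⊤) (hφ : IsFaithfulInvariantState α φ)
    (h : (∃ (X : Type*) (_ : TopologicalSpace X) (_ : CompactSpace X) (_ : T2Space X),
        3 ≤ ENat.card X ∧ Nonempty (A ≃⋆ₐ[ℂ] C(X, ℂ))) ∨
      ¬ Nonempty (fcCenter Γ ≃* Multiplicative (ZMod 2)))
    (hπ : Function.Injective π) :
    ∃ D : StarSubalgebra ℂ (L2 Γ H →L[ℂ] L2 Γ H),
      IsClosed (D : Set (L2 Γ H →L[ℂ] L2 Γ H)) ∧ reducedGroupCStar Γ H ≤ D ∧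
      D ≤ reducedCrossedProduct α π ⊤ ∧ ¬ IsSubCrossedProduct α π D ∧
      D ⊓ (regularRep α π).range = ⊥ := by
  by_cases hfc : ∃ s ∈ fcCenter Γ, s ≠ 1
  swap
  · exact exists_intermediate_of_icc hΓ (fun t ht hfin => hfc ⟨t, hfin, ht⟩) hφ hπ hA
  obtain ⟨s, hs, hs1⟩ := hfc
  -- Failure means that `s` is an involution (take `t = s`) and that the FC-center is exactly `{1,
  -- s}`.
  by_cases ht : ∃ t ∈ fcCenter Γ, t ≠ 1 ∧ s * t ≠ 1
  · obtain ⟨t, ht, ht1, hst⟩ := ht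
    have hS : (Group.conjugatesOfSet {s, t}).Finite := by
      refine Set.Finite.biUnion (Set.toFinite _) ?_
      rintro r (rfl | rfl)
      · exact hs
      · exact ht
    set N := Subgroup.normalClosure ({s, t} : Set Γ)
    let Z : Subgroup Γ := N ⊓ Subgroup.centralizer (N : Set Γ)
    -- If the center `Z` of `N` is finite, so is `N`, and `s, t` serve directly. Otherwise `Z` is an
    -- infinite abelian normal subgroup with room for `u, v ≠ 1` satisfying `uv ≠ 1`.
    by_cases hZ : (Z : Set Γ).Finite
    · obtain ⟨f, hf, hf'⟩ :=
        exists_functional_of_finite N (finite_normalClosure_of_finite_center hS hZ)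
      have hmem : ({s, t} : Set Γ) ⊆ N := Subgroup.subset_normalClosure
      exact exists_intermediate_of_normal hφ hπ N hf hf' (hmem (by simp)) (hmem (by simp)) hs1 ht1
        (Or.inl ⟨hst, hA⟩)
    · obtain ⟨f, hf, hf'⟩ := exists_functional_of_commutative Z fun a b =>
        Subtype.ext (Subgroup.mem_centralizer_iff.mp b.2.2 a a.2.1)
      obtain ⟨u, hu, hu1⟩ := Set.Infinite.exists_notMem_finite hZ (Set.finite_singleton 1)
      obtain ⟨v, hv, hv1⟩ := Set.Infinite.exists_notMem_finite hZ (Set.toFinite {1, u⁻¹})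
      rw [Set.mem_insert_iff, Set.mem_singleton_iff, not_or] at hv1
      have : Z.Normal := inferInstanceAs (N ⊓ Subgroup.centralizer (N : Set Γ)).Normal
      exact exists_intermediate_of_normal hφ hπ Z hf hf' hu hv hu1 hv1.1
        (Or.inl ⟨fun huv => hv1.2 (eq_inv_of_mul_eq_one_right huv), hA⟩)
  · have hss : s * s = 1 := by
      by_contra hne
      exact ht ⟨s, hs, hs1, hne⟩
    have hcarrier : (fcCenter Γ : Set Γ) = {1, s} := by
      ext t
      constructor
      · intro h1
        by_contra h2
        rw [Set.mem_insert_iff, Set.mem_singleton_iff, not_or] at h2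
        exact ht ⟨t, h1, h2.1, fun h3 => h2.2 (mul_left_cancel (h3.trans hss.symm))⟩
      · rintro (rfl | rfl)
        · exact (fcCenter Γ).one_mem
        · exact hs
    have hcard : Nat.card (fcCenter Γ) = 2 := by
      change Nat.card ((fcCenter Γ : Set Γ) : Type _) = 2
      rw [hcarrier, Nat.card_coe_set_eq, Set.ncard_pair hs1.symm]
    obtain ⟨X, _, _, _, hX, ⟨e⟩⟩ := h.resolve_right (not_not.mpr
      ⟨mulEquivOfPrimeCardEq (p := 2) hcard (by simp)⟩)
    obtain ⟨f, hf, hf'⟩ := exists_functional_of_finite (fcCenter Γ)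
      (by rw [hcarrier]; exact Set.toFinite _)
    -- The involution `s` plays both roles, so the obstruction is `a + s a`, transported to `C(X)`
    -- along `e`.
    refine exists_intermediate_of_normal hφ hπ (fcCenter Γ) hf hf' hs hs hs1 hs1
      (Or.inr ⟨hss, fun hall => ?_⟩)
    refine ContinuousMap.not_forall_add_mem_bot hX
      (((e : A →⋆ₐ[ℂ] C(X, ℂ)).comp (α s : A →⋆ₐ[ℂ] A)).comp (e.symm : C(X, ℂ) →⋆ₐ[ℂ] A))
      fun F => ?_
    obtain ⟨c, hc⟩ := Algebra.mem_bot.mp (hall (e.symm F))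
    have h1 : F + e (α s (e.symm F)) = algebraMap ℂ C(X, ℂ) c := by
      have h2 := congrArg e hc
      rw [AlgHomClass.commutes, map_add, StarAlgEquiv.apply_symm_apply] at h2
      exact h2.symm
    change F + e (α s (e.symm F)) ∈ (⊥ : StarSubalgebra ℂ C(X, ℂ))
    rw [h1]
    exact algebraMap_mem _ c

end

/-- Integration against an invariant probability measure of full support is a faithful invariant
state. -/
theorem exists_isFaithfulInvariantState_functionAction {Γ : Type*} [Group Γ] {X : Type*}
    [TopologicalSpace X] [CompactSpace X] [MeasurableSpace X] [BorelSpace X]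
    [MulAction Γ X] [ContinuousConstSMul Γ X] (μ : MeasureTheory.Measure X)
    [MeasureTheory.IsProbabilityMeasure μ] [μ.IsOpenPosMeasure]
    (hμ : ∀ s : Γ, μ.map (fun y => s • y) = μ) :
    ∃ φ : C(X, ℂ) →ₗ[ℂ] ℂ, IsFaithfulInvariantState (functionAction Γ X) φ := by
  have hint : ∀ f : C(X, ℂ), MeasureTheory.Integrable f μ := fun f =>
    f.continuous.integrable_of_hasCompactSupport (HasCompactSupport.of_compactSpace f)
  have hsq : ∀ f : C(X, ℂ), ∫ x, (star f * f) x ∂μ = ((∫ x, ‖f x‖ ^ 2 ∂μ : ℝ) : ℂ) := by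
    intro f
    rw [← integral_complex_ofReal]
    refine MeasureTheory.integral_congr_ae (Filter.Eventually.of_forall fun x => ?_)
    simp [Complex.conj_mul']
  refine ⟨{ toFun := fun f => ∫ x, f x ∂μ
            map_add' := fun f g => MeasureTheory.integral_add (hint f) (hint g)
            map_smul' := fun c f => MeasureTheory.integral_const_mul c f }, ?_, ?_, ?_, ?_⟩
  · intro f
    change 0 ≤ ∫ x, (star f * f) x ∂μ
    rw [hsq]
    exact Complex.zero_le_real.mpr (MeasureTheory.integral_nonneg fun x => by positivity)
  · change ∫ x, (1 : C(X, ℂ)) x ∂μ = 1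
    simp
  · intro f hf
    change ∫ x, (star f * f) x ∂μ = 0 at hf
    rw [hsq, Complex.ofReal_eq_zero] at hf
    have hcont : Continuous fun x => ‖f x‖ ^ 2 := by fun_prop
    have h1 := (MeasureTheory.integral_eq_zero_iff_of_nonneg (fun x => by positivity)
      (hcont.integrable_of_hasCompactSupport (HasCompactSupport.of_compactSpace _))).mp hf
    have h2 := (hcont.ae_eq_iff_eq μ continuous_zero).mp h1
    ext x
    have h3 : ‖f x‖ ^ 2 = 0 := congrFun h2 x
    simpa using h3
  · intro s f
    change ∫ x, f (s⁻¹ • x) ∂μ = ∫ x, f x ∂μ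
    have hs := hμ s⁻¹
    conv_rhs => rw [← hs]
    rw [MeasureTheory.integral_map (by fun_prop) f.continuous.aestronglyMeasurable]

theorem ContinuousMap.starSubalgebra_bot_ne_top {X : Type*} [TopologicalSpace X] [CompactSpace X]
    [T2Space X] (hX : 3 ≤ ENat.card X) : (⊥ : StarSubalgebra ℂ C(X, ℂ)) ≠ ⊤ := fun h =>
  ContinuousMap.not_forall_add_mem_bot hX (StarAlgHom.id ℂ C(X, ℂ)) fun f => by
    rw [h]
    trivial

theorem isSubCrossedProduct_reducedGroupCStar {Γ : Type*} [Group Γ] {A : Type*} [CStarAlgebra A]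
    (α : Γ →* (A ≃⋆ₐ[ℂ] A)) {H : Type*} [NormedAddCommGroup H] [InnerProductSpace ℂ H]
    [CompleteSpace H] (π : A →⋆ₐ[ℂ] (H →L[ℂ] H)) :
    IsSubCrossedProduct α π (reducedGroupCStar Γ H) := by
  refine ⟨⊥, ?_, fun s b hb => ?_, (reducedCrossedProduct_bot α π).symm⟩
  · have h : ((⊥ : StarSubalgebra ℂ A) : Set A)
        = ((Subalgebra.toSubmodule (⊥ : Subalgebra ℂ A) : Submodule ℂ A) : Set A) := rfl
    rw [h, Algebra.toSubmodule_bot, Submodule.one_eq_span]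
    exact Submodule.closed_of_finiteDimensional _
  · obtain ⟨c, rfl⟩ := Algebra.mem_bot.mp hb
    rw [AlgHomClass.commutes]
    exact algebraMap_mem _ c

end

theorem theorem1p9 {Γ : Type*} [Group Γ] (hΓ : ¬ IsCStarSimple Γ) :
    -- the theorem for a general unital `Γ`-C⋆-algebra `A`
    (∀ (A : Type*) [CStarAlgebra A] (α : Γ →* (A ≃⋆ₐ[ℂ] A)),
      (⊥ : StarSubalgebra ℂ A) ≠ ⊤ →
      (∃ φ : A →ₗ[ℂ] ℂ, IsFaithfulInvariantState α φ) →
      ((∃ (X : Type*) (_ : TopologicalSpace X) (_ : CompactSpace X) (_ : T2Space X),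
          3 ≤ ENat.card X ∧ Nonempty (A ≃⋆ₐ[ℂ] C(X, ℂ))) ∨
        ¬ Nonempty (fcCenter Γ ≃* Multiplicative (ZMod 2))) →
      ∀ (H : Type*) [NormedAddCommGroup H] [InnerProductSpace ℂ H] [CompleteSpace H]
        (π : A →⋆ₐ[ℂ] (H →L[ℂ] H)), Function.Injective π →
      ∃ D : StarSubalgebra ℂ (L2 Γ H →L[ℂ] L2 Γ H),
        IsClosed (D : Set (L2 Γ H →L[ℂ] L2 Γ H)) ∧
        reducedGroupCStar Γ H ≤ D ∧ D ≤ reducedCrossedProduct α π ⊤ ∧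
        ¬ IsSubCrossedProduct α π D ∧
        ((∀ a b : A, a * b = b * a) → D ⊓ (regularRep α π).range = ⊥)) ∧
    -- the case of `C(X)` for a compact `Γ`-space `X` with an invariant measure of full support
    (∀ (X : Type*) [TopologicalSpace X] [CompactSpace X] [T2Space X] [MeasurableSpace X]
        [BorelSpace X] [MulAction Γ X] [ContinuousConstSMul Γ X] (μ : MeasureTheory.Measure X)
        [MeasureTheory.IsProbabilityMeasure μ] [μ.IsOpenPosMeasure],
      (∀ s : Γ, μ.map (fun y => s • y) = μ) →
      3 ≤ ENat.card X →
      ∀ (H : Type*) [NormedAddCommGroup H] [InnerProductSpace ℂ H] [CompleteSpace H]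
        (π : C(X, ℂ) →⋆ₐ[ℂ] (H →L[ℂ] H)), Function.Injective π →
      ∃ D : StarSubalgebra ℂ (L2 Γ H →L[ℂ] L2 Γ H),
        IsClosed (D : Set (L2 Γ H →L[ℂ] L2 Γ H)) ∧
        reducedGroupCStar Γ H < D ∧ D < reducedCrossedProduct (functionAction Γ X) π ⊤ ∧
        ¬ IsSubCrossedProduct (functionAction Γ X) π D ∧
        D ⊓ (regularRep (functionAction Γ X) π).range = ⊥) := by
  refine ⟨?_, ?_⟩
  · intro A _ α hA hφ h H _ _ _ π hπ
    obtain ⟨φ, hφ⟩ := hφ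
    obtain ⟨D, h1, h2, h3, h4, h5⟩ := exists_intermediate hΓ hA hφ h hπ
    exact ⟨D, h1, h2, h3, h4, fun _ => h5⟩
  · intro X _ _ _ _ _ _ _ μ _ _ hμ hX H _ _ _ π hπ
    obtain ⟨φ, hφ⟩ := exists_isFaithfulInvariantState_functionAction μ hμ
    obtain ⟨D, h1, h2, h3, h4, h5⟩ := exists_intermediate hΓ
      (ContinuousMap.starSubalgebra_bot_ne_top hX) hφ
      (Or.inl ⟨X, _, inferInstance, inferInstance, hX, ⟨StarAlgEquiv.refl _ _⟩⟩) hπ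
    -- Both inclusions are strict because the extremes are themselves crossed products, with
    -- coefficients `ℂ` and `C(X)`.
    refine ⟨D, h1, lt_of_le_of_ne h2 ?_, lt_of_le_of_ne h3 ?_, h4, h5⟩
    · rintro rfl
      exact h4 (isSubCrossedProduct_reducedGroupCStar _ _)
    · rintro rfl
      exact h4 ⟨⊤, isClosed_univ, fun _ _ _ => trivial, rfl⟩
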